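/- Let $n\ge 3$. For $\lambda>0$ write points of $\mathbb{R}^{n+1}$ as $(x',x_n,x_{n+1})$ with $x'\in\mathbb{R}^{n-1}$, put $\omega_\lambda(x',t)=\lambda\sqrt{|x'|^2+t^2}$, and consider the circular cone and its axial hyperplane section $$\Omega_\lambda=\{(x',x_n,x_{n+1}) : x_n>\omega_\lambda(x',x_{n+1})\},\qquad \Sigma=\{x\in\Omega_\lambda : x_{n+1}=0\}.$$ For a Lipschitz function $f:\overline\Sigma\to\mathbb{R}$ whose support $\operatorname{spt} f$ is compact in $\overline\Sigma$, let $$\Phi[f](x,t)=\bigl(x',\,x_n+\omega_\lambda(x',tf(x))-\omega_\lambda(x',0),\,tf(x)\bigr),\qquad x\in\overline\Sigma,\ t\in\mathbb{R},$$ let $A[f](t)=\mathcal{H}^n\bigl(\Phi[f](\Sigma\cap\operatorname{spt} f,\,t)\bigr)$, where $\mathcal{H}^n$ is the $n$-dimensional Hausdorff measure normalized to agree with Lebesgue measure on $n$-planes, let $\mathcal{A}[f](s)=A[f](\sqrt s)$ for $s\ge 0$, and define $$\underline{\partial_t}A[f](0^+)=\liminf_{t\to0^+}\frac{A[f](t)-A[f](0)}{t},\qquad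 \underline{\partial_s}\mathcal{A}[f](0^+)=\liminf_{s\to0^+}\frac{\mathcal{A}[f](s)-\mathcal{A}[f](0)}{s},$$ $$\underline{\partial_t^2}A[f](0^+)=2\liminf_{t\to0^+}\frac{A[f](t)-A[f](0)}{t^2}.$$ Then there is a threshold $\lambda^*=\lambda^*(n)>0$ such that, for every $0<\lambda\le\lambda^*$ and every Lipschitz function $f:\overline\Sigma\to\mathbb{R}$ with compact support, the lower right first variation vanishes, $\underline{\partial_t}A[f](0^+)=0$, and $$\underline{\partial_s}\mathcal{A}[f](0^+)\ge 0,\qquad \underline{\partial_t^2}A[f](0^+)\ge 0,$$ with both inequalities strict whenever $f$ is not identically zero. That is, $\Sigma$ is a strictly stable free-boundary minimal surface in $\Omega_\lambda$. -/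

import Mathlib

open Set Filter Topology

noncomputable section

namespace ConeStability

/-- The Euclidean space `ℝⁿ⁺¹`. Its points are written `(x', x_n, x_{n+1})` with `x' ∈ ℝⁿ⁻¹`; since
indices start at `0`, `x'` consists of the coordinates with index `i < n - 1`, `x_n` is the one with
index `n - 1`, and `x_{n+1}` is the last one, with index `n` (all this for `n ≥ 1`). -/
abbrev Ambient (n : ℕ) : Type := EuclideanSpace ℝ (Fin (n + 1))

/-- The index of the coordinate `x_n`, along the axis of the cone. -/
def axis (n : ℕ) : Fin (n + 1) := ⟨n - 1, by omega⟩

/-- The function `ω_λ(x', t) = λ √(|x'|² + t²)`; only the part `x'` of the point `x` is used. -/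
def omega (n : ℕ) (lam : ℝ) (x : Ambient n) (t : ℝ) : ℝ :=
  lam * Real.sqrt
    ((∑ i ∈ Finset.univ.filter (fun i : Fin (n + 1) => (i : ℕ) < n - 1), x i ^ 2) + t ^ 2)

/-- The open circular cone `Ω_λ = {x_n > ω_λ(x', x_{n+1})}`. -/
def cone (n : ℕ) (lam : ℝ) : Set (Ambient n) :=
  {x | omega n lam x (x (Fin.last n)) < x (axis n)}

/-- The axial hyperplane section `Σ = {x ∈ Ω_λ : x_{n+1} = 0}`. -/
def axialSection (n : ℕ) (lam : ℝ) : Set (Ambient n) :=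
  {x | x ∈ cone n lam ∧ x (Fin.last n) = 0}

/-- The curve `Γ_x(t) = (x', x_n + ω_λ(x', t) - ω_λ(x', 0), t)`. -/
def curve (n : ℕ) (lam : ℝ) (x : Ambient n) (t : ℝ) : Ambient n :=
  WithLp.toLp 2 fun i =>
    if i = Fin.last n then t
    else if i = axis n then x i + omega n lam x t - omega n lam x 0
    else x i

/-- The flow `Φ[f](x, t) = Γ_x(t f(x))` associated to a function `f` on the closure of `Σ`. -/
def flow (n : ℕ) (lam : ℝ) (f : closure (axialSection n lam) → ℝ)
    (x : closure (axialSection n lam)) (t : ℝ) : Ambient n :=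
  curve n lam x (t * f x)

/-- The area `A[f](t)`: the `n`-dimensional Hausdorff measure, normalized to agree with Lebesgue
measure on `n`-planes, of the image of `Σ ∩ spt f` under `Φ[f](·, t)`. -/
def area (n : ℕ) (lam : ℝ) (f : closure (axialSection n lam) → ℝ) (t : ℝ) : ENNReal :=
  MeasureTheory.Measure.euclideanHausdorffMeasure n
    ((fun x => flow n lam f x t) '' {x | (x : Ambient n) ∈ axialSection n lam ∧ x ∈ tsupport f})

/-- The lower right first variation `liminf_{t → 0⁺} (A[f](t) - A[f](0)) / t`. -/
def lowerFirstVariation (n : ℕ) (lam : ℝ) (f : closure (axialSection n lam) → ℝ) : EReal :=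
  liminf (fun t : ℝ => ((area n lam f t : EReal) - (area n lam f 0 : EReal)) / (t : EReal))
    (𝓝[>] (0 : ℝ))

/-- The lower right second variation `2 liminf_{t → 0⁺} (A[f](t) - A[f](0)) / t²`
(meaningful when the lower right first variation is zero). -/
def lowerSecondVariation (n : ℕ) (lam : ℝ) (f : closure (axialSection n lam) → ℝ) : EReal :=
  2 * liminf
    (fun t : ℝ => ((area n lam f t : EReal) - (area n lam f 0 : EReal)) / ((t ^ 2 : ℝ) : EReal))
    (𝓝[>] (0 : ℝ))

/-- The lower right derivative at `s = 0` of `𝒜[f](s) = A[f](√s)`. -/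
def lowerDerivSqrt (n : ℕ) (lam : ℝ) (f : closure (axialSection n lam) → ℝ) : EReal :=
  liminf
    (fun s : ℝ => ((area n lam f (Real.sqrt s) : EReal) - (area n lam f (Real.sqrt 0) : EReal)) /
      (s : EReal))
    (𝓝[>] (0 : ℝ))

end ConeStability

end

/-! Split off the last coordinate and write the section as the solid cone `u > λ|w|`, with `w` in
dimension `n - 1 ≥ 2`. With `v = t f`, the deformed surface is the image of `x ↦ (x + lift(x) e,
v(x))`, where `e` is the axial direction and `lift = λ(√(|w|² + v²) - |w|)`. This map is Lipschitz
and injective, so by the area formula its area is the integral of its Jacobian `√((1 + k)² + |∇v -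
(β ∂ₑv) p|²)`. Here `k = ∂ₑ lift`, `p` is the differential of `|w|` and `|β| ≤ λ`. When `λ` and
`|∇v|` are small, this lies between `1 + k + |∇v|²/8` and `1 + k + 4|∇v|²` (`jacobian_bounds`).

The only term without a sign is `k`. It is an exact vertical derivative, so its integral over the
cone equals minus the integral of `lift` over the boundary graph `u = λ|w|`. Since `0 ≤ lift ≤ (λ/2)
v²/|w|`, the loss is at most a multiple of `λ` times `∫ v²/|w|` on the boundary. This trace is
dominated by the Dirichlet energy (`trace_inequality`): a vertical segment of length `|w|` reduces
it to `∫ v²/|x|²` and `∫ |∇v|²` inside the cone, and Hardy's inequality (`hardy_inequality`, which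
needs dimension at least three) absorbs the former. The loss is thus at most `21 λ ∫|∇v|²`, and for
`λ ≤ 1/400` half of the gain `∫|∇v|²/8` survives.

Hence `A(t) - A(0)` lies between two multiples of `t² ∫|∇f|²` for small `t ≥ 0`
(`exists_area_bounds`), which gives all the variations. If the energy vanishes, Hardy's inequality
forces `f = 0`, and this gives strictness. -/

noncomputable section

namespace ConeStability

open MeasureTheory Measure Module Function
open scoped ENNReal NNReal

/-! ### Area formula for Hausdorff measure of injective images. -/

section AreaFormula

/-- If `f` is `K`-Lipschitz on `s` relative to `g`, the image under `f` is controlled by the image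
under `g`. -/
theorem euclideanHausdorffMeasure_image_le_of_edist_le {X Y Z : Type*}
    [EMetricSpace Y] [MeasurableSpace Y] [BorelSpace Y]
    [EMetricSpace Z] [MeasurableSpace Z] [BorelSpace Z] {f : X → Y} {g : X → Z} {s : Set X}
    {K : ℝ≥0} (d : ℕ) (h : ∀ x ∈ s, ∀ y ∈ s, edist (f x) (f y) ≤ K * edist (g x) (g y)) :
    euclideanHausdorffMeasure d (f '' s) ≤ (K : ℝ≥0∞) ^ d * euclideanHausdorffMeasure d (g '' s) := by
  rcases s.eq_empty_or_nonempty with rfl | ⟨x₀, hx₀⟩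
  · simp
  have : Nonempty X := ⟨x₀⟩
  -- The hypothesis makes `f` constant on the fibres of `g` in `s`, so `f` factors through `g` on
  -- `s` by a `K`-Lipschitz map, whatever right inverse is chosen.
  set φ : Z → Y := f ∘ invFunOn g s
  have hmem : ∀ x ∈ s, invFunOn g s (g x) ∈ s := fun x hx => invFunOn_mem ⟨x, hx, rfl⟩
  have heq : ∀ x ∈ s, g (invFunOn g s (g x)) = g x := fun x hx => invFunOn_eq ⟨x, hx, rfl⟩
  have hφ : LipschitzOnWith K φ (g '' s) := by
    rintro _ ⟨x, hx, rfl⟩ _ ⟨y, hy, rfl⟩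
    refine (h _ (hmem x hx) _ (hmem y hy)).trans ?_
    rw [heq x hx, heq y hy]
  have himg : φ '' (g '' s) = f '' s := by
    rw [image_image]
    refine image_congr fun x hx => ?_
    have := h _ (hmem x hx) _ hx
    rw [heq x hx, edist_self, mul_zero, nonpos_iff_eq_zero, edist_eq_zero] at this
    exact this
  have key := hφ.hausdorffMeasure_image_le (d := d) (by positivity)
  rw [himg, ENNReal.rpow_natCast] at key
  simp only [euclideanHausdorffMeasure_def, Measure.smul_apply, Measure.nnreal_smul_coe_apply]
  calc _ ≤ _ := mul_le_mul_right key _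
    _ = _ := by ring

variable {U Y : Type*} [NormedAddCommGroup U] [InnerProductSpace ℝ U] [FiniteDimensional ℝ U]
  [MeasurableSpace U] [BorelSpace U] [NormedAddCommGroup Y] [InnerProductSpace ℝ Y]
  [SecondCountableTopology Y] [MeasurableSpace Y] [BorelSpace Y]
  {F : U → Y} {F' : U → U →L[ℝ] Y} {s : Set U}

/-- On each piece `F` is so close to a linear map `A n` that the distances `‖F x - F y‖` and `‖A n
(x - y)‖` agree up to the factors `1 ± ε`. Each image then controls the measure of the other. Every
`A n` is some `F' y`, which carries injectivity and Jacobian bounds over to it. -/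
theorem exists_partition_euclideanHausdorffMeasure_image
    (hF : ∀ x ∈ s, HasFDerivWithinAt F (F' x) s x)
    (hinj' : ∀ x ∈ s, Injective (F' x)) {ε : ℝ≥0} (hε : 0 < ε) (hε1 : ε < 1) :
    ∃ (t : ℕ → Set U) (A : ℕ → U →L[ℝ] Y), Pairwise (Disjoint on t) ∧ (∀ n, MeasurableSet (t n)) ∧
      s ⊆ ⋃ n, t n ∧ (s.Nonempty → ∀ n, ∃ y ∈ s, A n = F' y) ∧
      ∀ n, euclideanHausdorffMeasure (finrank ℝ U) (F '' (s ∩ t n)) ≤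
          ((1 + ε : ℝ≥0) : ℝ≥0∞) ^ finrank ℝ U *
            (ENNReal.ofReal (A n).toLinearMap.normDet * volume (s ∩ t n)) ∧
        ENNReal.ofReal (A n).toLinearMap.normDet * volume (s ∩ t n) ≤
          (((1 - ε)⁻¹ : ℝ≥0) : ℝ≥0∞) ^ finrank ℝ U *
            euclideanHausdorffMeasure (finrank ℝ U) (F '' (s ∩ t n)) := by
  classical
  have hex : ∀ A : U →L[ℝ] Y, ∃ K : ℝ≥0, 0 < K ∧ (Injective A → AntilipschitzWith K A) := by
    intro A
    by_cases hA : Injective A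
    · obtain ⟨K, hK, h⟩ := A.toLinearMap.exists_antilipschitzWith (LinearMap.ker_eq_bot.2 hA)
      exact ⟨K, hK, fun _ => h⟩
    · exact ⟨1, one_pos, fun h => absurd h hA⟩
  choose K hKpos hK using hex
  -- The tolerance `ε / K A`, with `K A` the antilipschitz constant, turns an error relative to `‖x
  -- - y‖` into one relative to `‖A (x - y)‖`.
  obtain ⟨t, A, hdisj, hmeas, hcov, happ, hA⟩ :=
    exists_partition_approximatesLinearOn_of_hasFDerivWithinAt F s F' hF (fun A => ε / K A)
      (fun A => (div_pos hε (hKpos A)).ne')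
  refine ⟨t, A, hdisj, hmeas, hcov, hA, fun n => ?_⟩
  rw [← LinearMap.euclideanHausdorffMeasure_image_eq_normDet_mul_volume]
  rcases s.eq_empty_or_nonempty with rfl | hs
  · simp
  have hinjA : Injective (A n) := by
    obtain ⟨y, hy, h⟩ := hA hs n
    exact h ▸ hinj' y hy
  have hbound : ∀ x ∈ s ∩ t n, ∀ y ∈ s ∩ t n,
      ‖F x - F y - A n (x - y)‖ ≤ ε * ‖A n (x - y)‖ := by
    intro x hx y hy
    refine (happ n x hx y hy).trans ?_
    have h1 : ‖x - y‖ ≤ K (A n) * ‖A n (x - y)‖ := by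
      have := (hK (A n) hinjA).le_mul_dist (x - y) 0
      simpa [dist_eq_norm] using this
    have h2 : (0 : ℝ) < K (A n) := hKpos _
    rw [NNReal.coe_div, div_mul_eq_mul_div, div_le_iff₀ h2, mul_assoc]
    gcongr
    linarith
  have hε1' : (0 : ℝ) < 1 - ε := by
    have : (ε : ℝ) < 1 := hε1
    linarith
  constructor
  · refine euclideanHausdorffMeasure_image_le_of_edist_le (f := F) (g := A n) _ fun x hx y hy => ?_
    rw [edist_nndist, edist_nndist, ← ENNReal.coe_mul, ENNReal.coe_le_coe, ← NNReal.coe_le_coe]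
    simp only [NNReal.coe_mul, coe_nndist, NNReal.coe_add, NNReal.coe_one, dist_eq_norm]
    rw [← map_sub]
    have h1 := norm_add_le (F x - F y - A n (x - y)) (A n (x - y))
    rw [sub_add_cancel] at h1
    linarith [hbound x hx y hy]
  · refine euclideanHausdorffMeasure_image_le_of_edist_le (f := A n) (g := F) _ fun x hx y hy => ?_
    rw [edist_nndist, edist_nndist, ← ENNReal.coe_mul, ENNReal.coe_le_coe, ← NNReal.coe_le_coe]
    simp only [NNReal.coe_mul, coe_nndist, NNReal.coe_inv, NNReal.coe_sub hε1.le, NNReal.coe_one,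
      dist_eq_norm]
    rw [← map_sub, ← div_eq_inv_mul, le_div_iff₀ hε1']
    have h1 := norm_sub_norm_le (A n (x - y)) (F x - F y)
    rw [norm_sub_rev (A n (x - y))] at h1
    linarith [hbound x hx y hy]

omit [SecondCountableTopology Y] in
theorem measurableSet_image_of_hasFDerivWithinAt (hs : MeasurableSet s)
    (hF : ∀ x ∈ s, HasFDerivWithinAt F (F' x) s x) (hinj : InjOn F s) :
    MeasurableSet (F '' s) :=
  hs.image_of_continuousOn_injOn (fun x hx => (hF x hx).continuousWithinAt) hinj

theorem ennreal_le_of_forall_pow_mul {a b : ℝ≥0∞} (d : ℕ)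
    (h : ∀ q : ℝ≥0, 1 < q → a ≤ (q : ℝ≥0∞) ^ d * b) : a ≤ b := by
  have hc : Tendsto (fun q : ℝ≥0 => (q : ℝ≥0∞) ^ d * b) (𝓝[>] 1) (𝓝 (((1 : ℝ≥0) : ℝ≥0∞) ^ d * b)) := by
    refine Tendsto.mono_left ?_ nhdsWithin_le_nhds
    refine ENNReal.Tendsto.mul_const ?_ (Or.inl (by simp))
    exact ((ENNReal.continuous_pow d).comp ENNReal.continuous_coe).tendsto 1
  have := ge_of_tendsto hc (eventually_nhdsWithin_of_forall fun q hq => h q hq)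
  simpa using this

/-- Countable subadditivity over the pieces suffices, so `F` may overlap itself here. The reverse
bound needs injectivity, because there the measures of the image pieces must add up. -/
theorem euclideanHausdorffMeasure_image_le_of_normDet_le (hs : MeasurableSet s)
    (hF : ∀ x ∈ s, HasFDerivWithinAt F (F' x) s x)
    (hinj' : ∀ x ∈ s, Injective (F' x)) {C : ℝ≥0∞}
    (hC : ∀ x ∈ s, ENNReal.ofReal (F' x).toLinearMap.normDet ≤ C) :
    euclideanHausdorffMeasure (finrank ℝ U) (F '' s) ≤ C * volume s := by
  rcases s.eq_empty_or_nonempty with rfl | hne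
  · simp
  refine ennreal_le_of_forall_pow_mul (finrank ℝ U) fun q hq => ?_
  obtain ⟨ε, hε, hε1, hεq⟩ : ∃ ε : ℝ≥0, 0 < ε ∧ ε < 1 ∧ 1 + ε ≤ q := by
    refine ⟨min (q - 1) (1 / 2), lt_min (tsub_pos_of_lt hq) (by norm_num),
      (min_le_right _ _).trans_lt (by norm_num), ?_⟩
    calc 1 + min (q - 1) (1 / 2) ≤ 1 + (q - 1) := by gcongr; exact min_le_left _ _
      _ = q := add_tsub_cancel_of_le hq.le
  obtain ⟨t, A, hdisj, hmeas, hcov, hA, hb⟩ :=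
    exists_partition_euclideanHausdorffMeasure_image hF hinj' hε hε1
  have hs_eq : s = ⋃ n, s ∩ t n := by rw [← inter_iUnion, inter_eq_left.2 hcov]
  calc euclideanHausdorffMeasure (finrank ℝ U) (F '' s)
      = euclideanHausdorffMeasure (finrank ℝ U) (⋃ n, F '' (s ∩ t n)) := by
        rw [← image_iUnion, ← hs_eq]
    _ ≤ ∑' n, euclideanHausdorffMeasure (finrank ℝ U) (F '' (s ∩ t n)) := measure_iUnion_le _
    _ ≤ ∑' n, (q : ℝ≥0∞) ^ finrank ℝ U * (C * volume (s ∩ t n)) := by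
        refine ENNReal.tsum_le_tsum fun n => (hb n).1.trans ?_
        obtain ⟨y, hy, hAy⟩ := hA hne n
        have := hC y hy
        rw [← hAy] at this
        gcongr
    _ = (q : ℝ≥0∞) ^ finrank ℝ U * (C * volume s) := by
        rw [ENNReal.tsum_mul_left, ENNReal.tsum_mul_left, ← measure_iUnion, ← hs_eq]
        · exact fun i j hij => (hdisj hij).mono inter_subset_right inter_subset_right
        · exact fun n => hs.inter (hmeas n)

theorem le_euclideanHausdorffMeasure_image_of_le_normDet (hs : MeasurableSet s)
    (hF : ∀ x ∈ s, HasFDerivWithinAt F (F' x) s x) (hinj : InjOn F s)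
    (hinj' : ∀ x ∈ s, Injective (F' x)) {C : ℝ≥0∞}
    (hC : ∀ x ∈ s, C ≤ ENNReal.ofReal (F' x).toLinearMap.normDet) :
    C * volume s ≤ euclideanHausdorffMeasure (finrank ℝ U) (F '' s) := by
  rcases s.eq_empty_or_nonempty with rfl | hne
  · simp
  refine ennreal_le_of_forall_pow_mul (finrank ℝ U) fun q hq => ?_
  have hq0 : 0 < q := one_pos.trans hq
  obtain ⟨ε, hε, hε1, hεq⟩ : ∃ ε : ℝ≥0, 0 < ε ∧ ε < 1 ∧ (1 - ε)⁻¹ ≤ q := by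
    have hqi : q⁻¹ < 1 := inv_lt_one_of_one_lt₀ hq
    refine ⟨1 - q⁻¹, tsub_pos_of_lt hqi, tsub_lt_self one_pos (inv_pos.2 hq0), ?_⟩
    rw [tsub_tsub_cancel_of_le hqi.le, inv_inv]
  obtain ⟨t, A, hdisj, hmeas, hcov, hA, hb⟩ :=
    exists_partition_euclideanHausdorffMeasure_image hF hinj' hε hε1
  have hs_eq : s = ⋃ n, s ∩ t n := by rw [← inter_iUnion, inter_eq_left.2 hcov]
  have hdisj' : Pairwise (Disjoint on fun n => s ∩ t n) :=
    fun i j hij => (hdisj hij).mono inter_subset_right inter_subset_right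
  calc C * volume s = ∑' n, C * volume (s ∩ t n) := by
        rw [ENNReal.tsum_mul_left, ← measure_iUnion hdisj' fun n => hs.inter (hmeas n), ← hs_eq]
    _ ≤ ∑' n, (q : ℝ≥0∞) ^ finrank ℝ U *
          euclideanHausdorffMeasure (finrank ℝ U) (F '' (s ∩ t n)) := by
        refine ENNReal.tsum_le_tsum fun n => ?_
        obtain ⟨y, hy, hAy⟩ := hA hne n
        have := hC y hy
        rw [← hAy] at this
        calc C * volume (s ∩ t n) ≤ _ := mul_le_mul_left this _
          _ ≤ _ := (hb n).2
          _ ≤ _ := by gcongr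
    _ = (q : ℝ≥0∞) ^ finrank ℝ U * euclideanHausdorffMeasure (finrank ℝ U) (F '' s) := by
        rw [ENNReal.tsum_mul_left, ← measure_iUnion, ← image_iUnion, ← hs_eq]
        · intro i j hij
          exact disjoint_image_image fun x hx y hy hxy =>
            (hdisj hij).ne_of_mem hx.2 hy.2 (hinj hx.1 hy.1 hxy)
        · exact fun n => measurableSet_image_of_hasFDerivWithinAt (hs.inter (hmeas n))
            (fun x hx => (hF x hx.1).mono inter_subset_left) (hinj.mono inter_subset_left)

/-- The area formula for an injective map with injective derivatives. -/
theorem euclideanHausdorffMeasure_image_eq_lintegral (hs : MeasurableSet s)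
    (hF : ∀ x ∈ s, HasFDerivWithinAt F (F' x) s x) (hinj : InjOn F s)
    (hinj' : ∀ x ∈ s, Injective (F' x)) {J : U → ℝ} (hJ : Measurable J)
    (hJF : ∀ x ∈ s, (F' x).toLinearMap.normDet = J x) :
    euclideanHausdorffMeasure (finrank ℝ U) (F '' s) = ∫⁻ x in s, ENNReal.ofReal (J x) := by
  have hJpos : ∀ x ∈ s, 0 < J x := fun x hx => by
    rw [← hJF x hx]
    exact lt_of_le_of_ne (LinearMap.normDet_nonneg _)
      (Ne.symm (((F' x).toLinearMap.normDet_ne_zero_tfae.out 0 4).2 (hinj' x hx)))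
  have hmJ : Measurable fun x => ENNReal.ofReal (J x) := hJ.ennreal_ofReal
  have main : ∀ q : ℝ≥0, 1 < q →
      euclideanHausdorffMeasure (finrank ℝ U) (F '' s) ≤
          (q : ℝ≥0∞) ^ 1 * ∫⁻ x in s, ENNReal.ofReal (J x) ∧
        ∫⁻ x in s, ENNReal.ofReal (J x) ≤
          (q : ℝ≥0∞) ^ 1 * euclideanHausdorffMeasure (finrank ℝ U) (F '' s) := by
    intro q hq
    have hq' : (1 : ℝ≥0∞) < q := by exact_mod_cast hq
    have hq0 : (q : ℝ≥0∞) ≠ 0 := (one_pos.trans hq').ne'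
    -- On each level set `q ^ k ≤ J < q ^ (k + 1)` the Jacobian is constant up to a factor `q`, so
    -- the two constant-bound estimates apply; finally `q → 1`.
    set t : ℤ → Set U := fun k =>
      (fun x => ENNReal.ofReal (J x)) ⁻¹' Ico ((q : ℝ≥0∞) ^ k) ((q : ℝ≥0∞) ^ (k + 1)) with ht
    have hmeas : ∀ k, MeasurableSet (s ∩ t k) := fun k => hs.inter (hmJ measurableSet_Ico)
    have hdisj : Pairwise (Disjoint on t) := by
      have := (ENNReal.monotone_zpow hq'.le).pairwise_disjoint_on_Ico_succ
      exact fun i j hij => (this hij).preimage _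
    have hcov : s = ⋃ k, s ∩ t k := by
      rw [← inter_iUnion, eq_comm, inter_eq_left]
      intro x hx
      obtain ⟨k, hk⟩ := ENNReal.exists_mem_Ico_zpow (x := ENNReal.ofReal (J x))
        (by simpa using hJpos x hx) ENNReal.ofReal_ne_top hq' ENNReal.coe_ne_top
      exact mem_iUnion.2 ⟨k, hk⟩
    have hdisj' : Pairwise (Disjoint on fun n => s ∩ t n) :=
      fun i j hij => (hdisj hij).mono inter_subset_right inter_subset_right
    have hF' : ∀ k, ∀ x ∈ s ∩ t k, HasFDerivWithinAt F (F' x) (s ∩ t k) x :=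
      fun k x hx => (hF x hx.1).mono inter_subset_left
    have himg : euclideanHausdorffMeasure (finrank ℝ U) (F '' s) =
        ∑' k, euclideanHausdorffMeasure (finrank ℝ U) (F '' (s ∩ t k)) := by
      rw [← measure_iUnion, ← image_iUnion, ← hcov]
      · intro i j hij
        exact disjoint_image_image fun x hx y hy hxy =>
          (hdisj hij).ne_of_mem hx.2 hy.2 (hinj hx.1 hy.1 hxy)
      · exact fun k => measurableSet_image_of_hasFDerivWithinAt (hmeas k) (hF' k)
          (hinj.mono inter_subset_left)
    have hint : ∫⁻ x in s, ENNReal.ofReal (J x) = ∑' k, ∫⁻ x in s ∩ t k, ENNReal.ofReal (J x) := by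
      conv_lhs => rw [hcov]
      exact lintegral_iUnion hmeas hdisj' _
    have hlow : ∀ k, (q : ℝ≥0∞) ^ k * volume (s ∩ t k) ≤
        ∫⁻ x in s ∩ t k, ENNReal.ofReal (J x) := fun k => by
      rw [← setLIntegral_const]
      exact setLIntegral_mono' (hmeas k) fun x hx => hx.2.1
    have hupp : ∀ k, ∫⁻ x in s ∩ t k, ENNReal.ofReal (J x) ≤
        (q : ℝ≥0∞) ^ (k + 1) * volume (s ∩ t k) := fun k => by
      rw [← setLIntegral_const]
      exact setLIntegral_mono' (hmeas k) fun x hx => hx.2.2.le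
    have hpow : ∀ k : ℤ, (q : ℝ≥0∞) ^ (k + 1) = q * (q : ℝ≥0∞) ^ k := fun k => by
      rw [ENNReal.zpow_add hq0 ENNReal.coe_ne_top, zpow_one, mul_comm]
    rw [himg, hint, pow_one, ← ENNReal.tsum_mul_left, ← ENNReal.tsum_mul_left]
    refine ⟨ENNReal.tsum_le_tsum fun k => ?_, ENNReal.tsum_le_tsum fun k => ?_⟩
    · calc _ ≤ (q : ℝ≥0∞) ^ (k + 1) * volume (s ∩ t k) :=
            euclideanHausdorffMeasure_image_le_of_normDet_le (hmeas k) (hF' k)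
              (fun x hx => hinj' x hx.1) fun x hx => by rw [hJF x hx.1]; exact hx.2.2.le
        _ = q * ((q : ℝ≥0∞) ^ k * volume (s ∩ t k)) := by rw [hpow, mul_assoc]
        _ ≤ _ := mul_le_mul_right (hlow k) _
    · calc _ ≤ (q : ℝ≥0∞) ^ (k + 1) * volume (s ∩ t k) := hupp k
        _ = q * ((q : ℝ≥0∞) ^ k * volume (s ∩ t k)) := by rw [hpow, mul_assoc]
        _ ≤ _ := mul_le_mul_right (le_euclideanHausdorffMeasure_image_of_le_normDet (hmeas k)
            (hF' k) (hinj.mono inter_subset_left) (fun x hx => hinj' x hx.1)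
            fun x hx => by rw [hJF x hx.1]; exact hx.2.1) _
  exact le_antisymm (ennreal_le_of_forall_pow_mul 1 fun q hq => (main q hq).1)
    (ennreal_le_of_forall_pow_mul 1 fun q hq => (main q hq).2)

end AreaFormula

/-! ### Jacobian of a sheared graph. -/

section NormDet

variable {E : Type*} [NormedAddCommGroup E] [InnerProductSpace ℝ E]

/-- The linear map `ξ ↦ (ξ + a(ξ) e, b(ξ))`. -/
def shearGraph (e : E) (a b : E →L[ℝ] ℝ) : E →L[ℝ] WithLp 2 (E × ℝ) :=
  (WithLp.prodContinuousLinearEquiv 2 ℝ E ℝ).symm.toContinuousLinearMap.comp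
    ((ContinuousLinearMap.id ℝ E + a.smulRight e).prod b)

theorem shearGraph_apply (e : E) (a b : E →L[ℝ] ℝ) (x : E) :
    shearGraph e a b x = WithLp.toLp 2 (x + a x • e, b x) := rfl

variable [FiniteDimensional ℝ E]

/-- The Gram operator of a graph is the identity plus a rank-one term, that is, a transvection along
the gradient of `c`, with determinant `1 + ‖c‖²`. -/
theorem normDet_shearGraph_zero_sq (e : E) (c : E →L[ℝ] ℝ) :
    (shearGraph e 0 c).toLinearMap.normDet ^ 2 = 1 + ‖c‖ ^ 2 := by
  set v : E := (InnerProductSpace.toDual ℝ E).symm c with hv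
  have hinner : ∀ y, inner ℝ v y = c y := fun y => InnerProductSpace.toDual_symm_apply
  have h := LinearMap.normDet_sq (shearGraph e 0 c).toLinearMap
  have hcomp : (shearGraph e 0 c).toLinearMap.adjoint ∘ₗ (shearGraph e 0 c).toLinearMap =
      LinearMap.transvection c.toLinearMap v := by
    ext x
    refine ext_inner_right ℝ fun y => ?_
    rw [LinearMap.comp_apply, LinearMap.adjoint_inner_left, LinearMap.transvection.apply]
    simp [shearGraph_apply, WithLp.prod_inner_apply, inner_add_left, inner_smul_left, hinner,
      mul_comm]
  rw [hcomp, LinearMap.transvection.det] at h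
  have h1 : c v = ‖c‖ ^ 2 := by
    rw [← hinner v, real_inner_self_eq_norm_sq, hv, LinearIsometryEquiv.norm_map]
  have h2 : (shearGraph e 0 c).toLinearMap.normDet ^ 2 = 1 + c v := h
  rw [h2, h1]

theorem normDet_shearGraph (e : E) (a b : E →L[ℝ] ℝ) (h : 0 < 1 + a e) :
    (shearGraph e a b).toLinearMap.normDet =
      √((1 + a e) ^ 2 + ‖(1 + a e) • b - b e • a‖ ^ 2) := by
  set c : E →L[ℝ] ℝ := b - ((1 + a e)⁻¹ * b e) • a with hc
  -- The shear `x ↦ x + a(x) e`, of determinant `1 + a e`, is performed first in the source; `c` is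
  -- `b` read in the sheared variable, so only an unsheared graph remains.
  have hfac : (shearGraph e a b).toLinearMap =
      (shearGraph e 0 c).toLinearMap ∘ₗ LinearMap.transvection a.toLinearMap e := by
    have hb : ∀ x, b x = c x + a x * c e := fun x => by
      simp only [hc, FunLike.coe_sub, Pi.sub_apply, FunLike.coe_smul, Pi.smul_apply, smul_eq_mul]
      field_simp
      ring
    ext x
    simpa [shearGraph_apply, LinearMap.transvection.apply] using hb x
  have hcn : (1 + a e) * ‖c‖ = ‖(1 + a e) • b - b e • a‖ := by
    rw [← abs_of_pos h, ← Real.norm_eq_abs, ← norm_smul, Real.norm_eq_abs, abs_of_pos h, hc,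
      smul_sub, smul_smul, mul_inv_cancel_left₀ h.ne']
  rw [hfac, LinearMap.normDet_comp_of_finrank_eq _ _ rfl, LinearMap.normDet_eq_abs_det,
    LinearMap.transvection.det]
  symm
  rw [Real.sqrt_eq_iff_eq_sq (by positivity)
    (mul_nonneg (LinearMap.normDet_nonneg _) (abs_nonneg _)), mul_pow,
    normDet_shearGraph_zero_sq, sq_abs, ← hcn, ContinuousLinearMap.coe_coe]
  ring

theorem injective_shearGraph (e : E) (a b : E →L[ℝ] ℝ) (h : 0 < 1 + a e) :
    Injective (shearGraph e a b) := by
  have := (shearGraph e a b).toLinearMap.normDet_ne_zero_tfae.out 0 4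
  refine this.1 ?_
  rw [normDet_shearGraph e a b h]
  positivity

omit [FiniteDimensional ℝ E] in
/-- The tilt part of the Jacobian, when `a - α b` is small and does not see `e`. -/
theorem norm_shear_tilt (e : E) (b p : E →L[ℝ] ℝ) (α β : ℝ) (hp : p e = 0) :
    (1 + (α • b + β • p) e) • b - b e • (α • b + β • p) = b - (β * b e) • p := by
  ext x
  simp [hp]
  ring

end NormDet

/-! ### Hardy's inequality on dilation-invariant domains. -/

section Hardy

theorem enorm_sub_le_lintegral_deriv {φ : ℝ → ℝ} {K : ℝ≥0} (hφ : LipschitzWith K φ) {a b : ℝ}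
    (hab : a ≤ b) : ‖φ b - φ a‖ₑ ≤ ∫⁻ x in Ioc a b, ‖deriv φ x‖ₑ := by
  rw [← (hφ.lipschitzOnWith (s := uIcc a b)).absolutelyContinuousOnInterval.integral_deriv_eq_sub,
    intervalIntegral.integral_of_le hab]
  exact enorm_integral_le_lintegral_enorm _

theorem sq_lintegral_le_mul {α : Type*} [MeasurableSpace α] {μ : Measure α} {h w : α → ℝ≥0∞}
    (hh : AEMeasurable h μ) (hw : AEMeasurable w μ) (hw0 : ∀ᵐ x ∂μ, w x ≠ 0)
    (hwt : ∀ᵐ x ∂μ, w x ≠ ∞) :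
    (∫⁻ x, h x ∂μ) ^ 2 ≤ (∫⁻ x, (w x)⁻¹ ∂μ) * ∫⁻ x, w x * h x ^ 2 ∂μ := by
  have hpow : ∀ y : ℝ≥0∞, (y ^ (1 / 2 : ℝ)) ^ (2 : ℝ) = y := fun y => by
    rw [← ENNReal.rpow_mul]; norm_num
  have key := ENNReal.lintegral_mul_le_Lp_mul_Lq μ Real.HolderConjugate.two_two
    (f := fun x => (w x)⁻¹ ^ (1 / 2 : ℝ)) (g := fun x => w x ^ (1 / 2 : ℝ) * h x)
    (hw.inv.pow_const _) ((hw.pow_const _).mul hh)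
  have h1 : ∫⁻ x, ((fun x => (w x)⁻¹ ^ (1 / 2 : ℝ)) * fun x => w x ^ (1 / 2 : ℝ) * h x) x ∂μ =
      ∫⁻ x, h x ∂μ := by
    refine lintegral_congr_ae ?_
    filter_upwards [hw0, hwt] with x h0 ht
    rw [Pi.mul_apply, ← mul_assoc, ← ENNReal.mul_rpow_of_nonneg _ _ (by norm_num),
      ENNReal.inv_mul_cancel h0 ht, ENNReal.one_rpow, one_mul]
  have h2 : ∀ x, (w x ^ (1 / 2 : ℝ) * h x) ^ (2 : ℝ) = w x * h x ^ 2 := fun x => by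
    rw [ENNReal.mul_rpow_of_nonneg _ _ (by norm_num), hpow, ENNReal.rpow_two]
  rw [h1] at key
  simp only [hpow, h2] at key
  calc (∫⁻ x, h x ∂μ) ^ 2 ≤ _ := pow_le_pow_left' key 2
    _ = _ := by rw [mul_pow, ← ENNReal.rpow_two, ← ENNReal.rpow_two, hpow, hpow]

theorem lintegral_Ioi_one_rpow_neg_three_halves :
    ∫⁻ s in Ioi (1 : ℝ), ENNReal.ofReal (s ^ (-(3 / 2) : ℝ)) = 2 := by
  rw [← ofReal_integral_eq_lintegral_ofReal]
  · rw [integral_Ioi_rpow_of_lt (by norm_num) one_pos]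
    norm_num
  · exact integrableOn_Ioi_rpow_of_lt (by norm_num) one_pos
  · filter_upwards [ae_restrict_mem measurableSet_Ioi] with s hs
    exact Real.rpow_nonneg (one_pos.trans hs).le _

variable {E : Type*} [NormedAddCommGroup E] [InnerProductSpace ℝ E] [FiniteDimensional ℝ E]
  [MeasurableSpace E] [BorelSpace E]

theorem lintegral_comp_smul_le {Ω : Set E} (hΩ : MeasurableSet Ω) {s : ℝ} (hs : 0 < s)
    (hsΩ : ∀ x ∈ Ω, s • x ∈ Ω) {G : E → ℝ≥0∞} (hG : Measurable G) :
    ∫⁻ x in Ω, G (s • x) ≤ ENNReal.ofReal ((s ^ finrank ℝ E)⁻¹) * ∫⁻ x in Ω, G x := by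
  have h1 : ∫⁻ x, Ω.indicator G x ∂(Measure.map (fun x => s • x) (volume : Measure E)) =
      ∫⁻ x, Ω.indicator G (s • x) :=
    lintegral_map (hG.indicator hΩ) (measurable_const_smul s)
  rw [Measure.map_addHaar_smul _ hs.ne', lintegral_smul_measure, lintegral_indicator hΩ,
    abs_of_pos (by positivity)] at h1
  rw [← smul_eq_mul, h1, ← lintegral_indicator hΩ]
  refine lintegral_mono fun x => ?_
  by_cases hx : x ∈ Ω
  · simp [hx, hsΩ x hx]
  · simp [hx]

/-- Rademacher's theorem holds for each fixed dilation, and Fubini exchanges the quantifiers. This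
permits the chain rule along almost every ray. -/
theorem ae_ae_differentiableAt_smul {g : E → ℝ} {K : ℝ≥0} (hg : LipschitzWith K g) :
    ∀ᵐ x : E, ∀ᵐ s ∂(volume.restrict (Ioi (1 : ℝ))), DifferentiableAt ℝ g (s • x) := by
  have hmeas : MeasurableSet {p : E × ℝ | DifferentiableAt ℝ g (p.2 • p.1)} :=
    (measurable_snd.smul measurable_fst) (measurableSet_of_differentiableAt ℝ g)
  rw [Measure.ae_ae_comm hmeas]
  filter_upwards [ae_restrict_mem measurableSet_Ioi] with s hs
  have hs0 : s ≠ 0 := (one_pos.trans hs).ne'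
  have hq : QuasiMeasurePreserving (fun x : E => s • x) := by
    refine ⟨measurable_const_smul s, ?_⟩
    rw [Measure.map_addHaar_smul _ hs0]
    exact smul_absolutelyContinuous
  exact hq.ae hg.ae_differentiableAt

/-- Hardy's inequality on a domain invariant under dilations, with a non-sharp constant. -/
theorem hardy_inequality (hd : 3 ≤ finrank ℝ E) {Ω : Set E} (hΩ : MeasurableSet Ω)
    (hΩ0 : (0 : E) ∉ Ω) (hsΩ : ∀ s : ℝ, 1 ≤ s → ∀ x ∈ Ω, s • x ∈ Ω)
    {g : E → ℝ} {K : ℝ≥0} (hg : LipschitzWith K g) {R : ℝ} (hR : ∀ x ∈ Ω, R ≤ ‖x‖ → g x = 0) :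
    ∫⁻ x in Ω, ‖g x‖ₑ ^ 2 / ‖x‖ₑ ^ 2 ≤ 4 * ∫⁻ x in Ω, ‖fderiv ℝ g x‖ₑ ^ 2 := by
  set G : E → ℝ≥0∞ := fun x => ‖fderiv ℝ g x‖ₑ ^ 2 with hGdef
  have hG : Measurable G := (measurable_fderiv ℝ g).enorm.pow_const 2
  -- The exponent `3/2` makes `1/w` integrable at infinity and, after the dilation factor `s ^ (-d)`
  -- with `d ≥ 3`, leaves at most `s ^ (-3/2)`. Both integrals equal `2`, whence the constant `4`.
  set w : ℝ → ℝ≥0∞ := fun s => ENNReal.ofReal (s ^ (3 / 2 : ℝ)) with hw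
  have hwm : Measurable w := by fun_prop
  have hpt : ∀ᵐ x ∂(volume.restrict Ω), ‖g x‖ₑ ^ 2 / ‖x‖ₑ ^ 2 ≤
      2 * ∫⁻ s in Ioi (1 : ℝ), w s * G (s • x) := by
    filter_upwards [ae_restrict_of_ae (ae_ae_differentiableAt_smul hg), ae_restrict_mem hΩ]
      with x hdiff hx
    have hx0 : x ≠ 0 := fun h => hΩ0 (h ▸ hx)
    have hxpos : 0 < ‖x‖ := norm_pos_iff.2 hx0
    have h1 : ‖g x‖ₑ ≤ ∫⁻ s in Ioi (1 : ℝ), ‖x‖ₑ * ‖fderiv ℝ g (s • x)‖ₑ := by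
      -- Far enough along the ray through `x` the function vanishes, so `g x` is recovered by
      -- integrating the radial derivative from `1` to `b`.
      set b : ℝ := max 1 (R / ‖x‖)
      have hφ : LipschitzWith (K * ‖x‖₊) fun s : ℝ => g (s • x) := by
        refine hg.comp (LipschitzWith.of_dist_le_mul fun s t => ?_)
        rw [dist_eq_norm, ← sub_smul, norm_smul, mul_comm, dist_eq_norm]
        rfl
      have hb : g (b • x) = 0 := by
        refine hR _ (hsΩ _ (le_max_left _ _) x hx) ?_
        rw [norm_smul, Real.norm_of_nonneg (zero_le_one.trans (le_max_left _ _)),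
          ← div_le_iff₀ hxpos]
        exact le_max_right _ _
      have h2 := enorm_sub_le_lintegral_deriv hφ (le_max_left 1 (R / ‖x‖))
      change ‖g (b • x) - g ((1 : ℝ) • x)‖ₑ ≤ _ at h2
      rw [hb, one_smul, zero_sub, enorm_neg] at h2
      refine h2.trans ((lintegral_mono_set Ioc_subset_Ioi_self).trans (lintegral_mono_ae ?_))
      filter_upwards [hdiff] with s hs
      have hder : HasDerivAt (fun s : ℝ => g (s • x)) (fderiv ℝ g (s • x) x) s := by
        have hline : HasDerivAt (fun s : ℝ => s • x) x s := by
          simpa using (hasDerivAt_id s).smul_const x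
        exact hs.hasFDerivAt.comp_hasDerivAt s hline
      rw [hder.deriv, mul_comm]
      exact (fderiv ℝ g (s • x)).le_opENorm x
    have h2 := sq_lintegral_le_mul (μ := volume.restrict (Ioi (1 : ℝ)))
      (h := fun s => ‖x‖ₑ * ‖fderiv ℝ g (s • x)‖ₑ) (w := w)
      (by
        have : Measurable fun s : ℝ => ‖fderiv ℝ g (s • x)‖ₑ :=
          ((measurable_fderiv ℝ g).comp (measurable_id.smul_const x)).enorm
        exact (this.const_mul _).aemeasurable) hwm.aemeasurable
      (by
        filter_upwards [ae_restrict_mem measurableSet_Ioi] with s hs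
        have : (0 : ℝ) < s := one_pos.trans hs
        simp only [hw, ne_eq, ENNReal.ofReal_eq_zero, not_le]
        positivity)
      (Eventually.of_forall fun s => ENNReal.ofReal_ne_top)
    have h3 : ∫⁻ s in Ioi (1 : ℝ), (w s)⁻¹ = 2 := by
      rw [← lintegral_Ioi_one_rpow_neg_three_halves]
      refine setLIntegral_congr_fun measurableSet_Ioi fun s hs => ?_
      have : (0 : ℝ) < s := one_pos.trans hs
      rw [Real.rpow_neg this.le, ENNReal.ofReal_inv_of_pos (by positivity)]
    have h4 : ∫⁻ s in Ioi (1 : ℝ), w s * (‖x‖ₑ * ‖fderiv ℝ g (s • x)‖ₑ) ^ 2 =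
        ‖x‖ₑ ^ 2 * ∫⁻ s in Ioi (1 : ℝ), w s * G (s • x) := by
      rw [← lintegral_const_mul]
      · refine lintegral_congr fun s => ?_
        rw [hGdef]
        ring
      · exact hwm.mul (hG.comp (measurable_id.smul_const x))
    rw [h3, h4] at h2
    refine ENNReal.div_le_of_le_mul ?_
    calc ‖g x‖ₑ ^ 2 ≤ _ := pow_le_pow_left' h1 2
      _ ≤ _ := h2
      _ = _ := by ring
  have hprod : Measurable fun p : E × ℝ => w p.2 * G (p.2 • p.1) :=
    (hwm.comp measurable_snd).mul (hG.comp (measurable_snd.smul measurable_fst))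
  calc ∫⁻ x in Ω, ‖g x‖ₑ ^ 2 / ‖x‖ₑ ^ 2
      ≤ ∫⁻ x in Ω, 2 * ∫⁻ s in Ioi (1 : ℝ), w s * G (s • x) := lintegral_mono_ae hpt
    _ = 2 * ∫⁻ x in Ω, ∫⁻ s in Ioi (1 : ℝ), w s * G (s • x) :=
        lintegral_const_mul _ hprod.lintegral_prod_right'
    _ = 2 * ∫⁻ s in Ioi (1 : ℝ), ∫⁻ x in Ω, w s * G (s • x) := by
        rw [lintegral_lintegral_swap hprod.aemeasurable]
    _ ≤ 2 * ∫⁻ s in Ioi (1 : ℝ),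
          ENNReal.ofReal (s ^ (-(3 / 2) : ℝ)) * ∫⁻ x in Ω, G x := by
        gcongr 2 * ?_
        refine setLIntegral_mono' measurableSet_Ioi fun s hs => ?_
        have hs1 : (1 : ℝ) < s := hs
        have hs0 : (0 : ℝ) < s := one_pos.trans hs1
        rw [lintegral_const_mul (f := fun x => G (s • x)) _ (hG.comp (measurable_const_smul s))]
        calc w s * ∫⁻ x in Ω, G (s • x)
            ≤ w s * (ENNReal.ofReal ((s ^ finrank ℝ E)⁻¹) * ∫⁻ x in Ω, G x) := by
              gcongr
              exact lintegral_comp_smul_le hΩ hs0 (hsΩ s hs1.le) hG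
          _ ≤ ENNReal.ofReal (s ^ (-(3 / 2) : ℝ)) * ∫⁻ x in Ω, G x := by
              rw [← mul_assoc]
              gcongr
              rw [hw, ← ENNReal.ofReal_mul (by positivity)]
              refine ENNReal.ofReal_le_ofReal ?_
              calc s ^ (3 / 2 : ℝ) * (s ^ finrank ℝ E)⁻¹ ≤ s ^ (3 / 2 : ℝ) * (s ^ 3)⁻¹ := by
                    gcongr
                    exact hs1.le
                _ = s ^ (-(3 / 2) : ℝ) := by
                    rw [← Real.rpow_natCast, ← Real.rpow_neg hs0.le, ← Real.rpow_add hs0]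
                    norm_num
    _ = 4 * ∫⁻ x in Ω, G x := by
        rw [lintegral_mul_const _ (by fun_prop), lintegral_Ioi_one_rpow_neg_three_halves,
          ← mul_assoc]
        norm_num

end Hardy

/-! ### Trace inequality on the boundary of the solid cone. -/

section Trace

variable {W : Type*} [NormedAddCommGroup W] [InnerProductSpace ℝ W]

/-- The cone `{(w, u) : u > λ |w|}` in `W × ℝ`. -/
def solidCone (W : Type*) [NormedAddCommGroup W] (lam : ℝ) : Set (WithLp 2 (W × ℝ)) :=
  {x | lam * ‖x.fst‖ < x.snd}

omit [InnerProductSpace ℝ W] in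
theorem isOpen_solidCone (lam : ℝ) : IsOpen (solidCone W lam) :=
  isOpen_lt (by fun_prop) (by fun_prop)

omit [InnerProductSpace ℝ W] in
theorem zero_notMem_solidCone (lam : ℝ) : (0 : WithLp 2 (W × ℝ)) ∉ solidCone W lam := by
  simp [solidCone]

theorem smul_mem_solidCone {lam s : ℝ} (hs : 0 < s) {x : WithLp 2 (W × ℝ)}
    (hx : x ∈ solidCone W lam) : s • x ∈ solidCone W lam := by
  simp only [solidCone, mem_ofPred_eq, WithLp.smul_fst, WithLp.smul_snd, norm_smul,
    Real.norm_of_nonneg hs.le, smul_eq_mul] at hx ⊢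
  calc lam * (s * ‖x.fst‖) = s * (lam * ‖x.fst‖) := by ring
    _ < s * x.snd := by gcongr

omit [InnerProductSpace ℝ W] in
theorem isometry_toLp_prodMk (w : W) : Isometry fun u : ℝ => WithLp.toLp 2 (w, u) := by
  refine Isometry.of_dist_eq fun u v => ?_
  rw [WithLp.prod_dist_eq_of_L2]
  simp [Real.sqrt_sq]

variable [FiniteDimensional ℝ W] [MeasurableSpace W] [BorelSpace W]

theorem lintegral_solidCone {lam : ℝ} {φ : WithLp 2 (W × ℝ) → ℝ≥0∞} (hφ : Measurable φ) :
    ∫⁻ x in solidCone W lam, φ x =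
      ∫⁻ w : W, ∫⁻ u in Ioi (lam * ‖w‖), φ (WithLp.toLp 2 (w, u)) := by
  have hm : MeasurableSet (solidCone W lam) := (isOpen_solidCone lam).measurableSet
  rw [← lintegral_indicator hm,
    ← (WithLp.volume_preserving_toLp W ℝ).lintegral_comp (hφ.indicator hm), volume_eq_prod,
    lintegral_prod (fun a => (solidCone W lam).indicator φ (WithLp.toLp 2 a))
      ((hφ.indicator hm).comp (WithLp.volume_preserving_toLp W ℝ).measurable).aemeasurable]
  refine lintegral_congr fun w => ?_
  rw [← lintegral_indicator measurableSet_Ioi]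
  rfl

theorem ae_ae_toLp_of_ae {p : WithLp 2 (W × ℝ) → Prop} (h : ∀ᵐ x, p x) :
    ∀ᵐ w : W, ∀ᵐ u : ℝ, p (WithLp.toLp 2 (w, u)) := by
  have := (WithLp.volume_preserving_toLp W ℝ).quasiMeasurePreserving.ae h
  rw [volume_eq_prod] at this
  exact ae_ae_of_ae_prod this

theorem add_sq_le_two_mul (a b : ℝ≥0∞) : (a + b) ^ 2 ≤ 2 * a ^ 2 + 2 * b ^ 2 := by
  have := ENNReal.rpow_add_le_mul_rpow_add_rpow a b (p := 2) (by norm_num)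
  norm_num at this
  rwa [mul_add] at this

omit [FiniteDimensional ℝ W] in
/-- A function is controlled on the boundary of the cone by its values and its gradient on a
vertical segment. -/
theorem vertical_trace_le {lam : ℝ} (hlam : 0 ≤ lam) (hlam1 : lam ≤ 1)
    {g : WithLp 2 (W × ℝ) → ℝ} {K : ℝ≥0} (hg : LipschitzWith K g) {w : W} (hw : w ≠ 0)
    (hdiff : ∀ᵐ u : ℝ, DifferentiableAt ℝ g (WithLp.toLp 2 (w, u))) :
    ‖g (WithLp.toLp 2 (w, lam * ‖w‖))‖ₑ ^ 2 / ‖w‖ₑ ≤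
      ∫⁻ u in Ioi (lam * ‖w‖), (10 * (‖g (WithLp.toLp 2 (w, u))‖ₑ ^ 2 /
        ‖(WithLp.toLp 2 (w, u) : WithLp 2 (W × ℝ))‖ₑ ^ 2) +
          2 * ‖fderiv ℝ g (WithLp.toLp 2 (w, u))‖ₑ ^ 2) := by
  set ℓ : ℝ → WithLp 2 (W × ℝ) := fun u => WithLp.toLp 2 (w, u) with hℓ
  have hℓm : Measurable ℓ := (isometry_toLp_prodMk w).continuous.measurable
  set r := ‖w‖ with hr
  have hrpos : 0 < r := norm_pos_iff.2 hw
  have hwr : ‖w‖ₑ = ENNReal.ofReal r := (ofReal_norm w).symm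
  have hr0 : ENNReal.ofReal r ≠ 0 := by simpa using hrpos
  have hrt : ENNReal.ofReal r ≠ ∞ := ENNReal.ofReal_ne_top
  -- Averaging over a segment whose length is the distance `r` to the axis makes both terms scale
  -- correctly. Since `λ ≤ 1`, its points have height at most `2r`, hence squared norm at most
  -- `5r²`; this explains the `10 = 2 · 5`.
  set I : Set ℝ := Ioc (lam * r) (lam * r + r) with hI
  have hvol : volume I = ENNReal.ofReal r := by rw [hI, Real.volume_Ioc, add_sub_cancel_left]
  have hDm : Measurable fun u => ‖fderiv ℝ g (ℓ u)‖ₑ := ((measurable_fderiv ℝ g).comp hℓm).enorm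
  have hgm : Measurable fun u => ‖g (ℓ u)‖ₑ := (hg.continuous.measurable.comp hℓm).enorm
  set B : ℝ≥0∞ := ∫⁻ u in I, ‖fderiv ℝ g (ℓ u)‖ₑ with hB
  have hB2 : B ^ 2 ≤ ENNReal.ofReal r * ∫⁻ u in I, ‖fderiv ℝ g (ℓ u)‖ₑ ^ 2 := by
    have := sq_lintegral_le_mul (μ := volume.restrict I) (w := fun _ => 1) hDm.aemeasurable
      aemeasurable_const (by simp) (by simp)
    simpa [hvol] using this
  have hseg : ∀ u ∈ I, ‖g (ℓ (lam * r))‖ₑ ≤ ‖g (ℓ u)‖ₑ + B := by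
    intro u hu
    have hφ : LipschitzWith K fun u => g (ℓ u) := by
      have := hg.comp (isometry_toLp_prodMk w).lipschitz
      rwa [mul_one] at this
    have h1 := enorm_sub_le_lintegral_deriv hφ hu.1.le
    have h2 : ∫⁻ x in Ioc (lam * r) u, ‖deriv (fun u => g (ℓ u)) x‖ₑ ≤ B := by
      refine (lintegral_mono_set (Ioc_subset_Ioc_right hu.2)).trans (lintegral_mono_ae ?_)
      filter_upwards [ae_restrict_of_ae hdiff] with v hv
      have hline : HasDerivAt ℓ (WithLp.toLp 2 ((0 : W), (1 : ℝ))) v := by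
        have h0 : HasDerivAt (fun u : ℝ => ((w, u) : W × ℝ)) (0, 1) v :=
          (hasDerivAt_const v w).prodMk (hasDerivAt_id v)
        exact (WithLp.prodContinuousLinearEquiv 2 ℝ W ℝ).symm.hasFDerivAt.comp_hasDerivAt v h0
      have hder := hv.hasFDerivAt.comp_hasDerivAt v hline
      rw [show (fun u => g (ℓ u)) = g ∘ ℓ from rfl, hder.deriv]
      refine ((fderiv ℝ g (ℓ v)).le_opENorm _).trans ?_
      have : ‖(WithLp.toLp 2 ((0 : W), (1 : ℝ)) : WithLp 2 (W × ℝ))‖ₑ = 1 := by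
        rw [← ofReal_norm, WithLp.prod_norm_eq_of_L2]
        simp
      rw [this, mul_one]
    calc ‖g (ℓ (lam * r))‖ₑ = ‖g (ℓ u) - (g (ℓ u) - g (ℓ (lam * r)))‖ₑ := by rw [sub_sub_cancel]
      _ ≤ ‖g (ℓ u)‖ₑ + ‖g (ℓ u) - g (ℓ (lam * r))‖ₑ := enorm_sub_le
      _ ≤ ‖g (ℓ u)‖ₑ + B := by gcongr; exact h1.trans h2
  have hint : ENNReal.ofReal r * ‖g (ℓ (lam * r))‖ₑ ^ 2 ≤
      2 * (∫⁻ u in I, ‖g (ℓ u)‖ₑ ^ 2) +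
        2 * (ENNReal.ofReal r * ENNReal.ofReal r * ∫⁻ u in I, ‖fderiv ℝ g (ℓ u)‖ₑ ^ 2) := by
    calc ENNReal.ofReal r * ‖g (ℓ (lam * r))‖ₑ ^ 2
        = ∫⁻ u in I, ‖g (ℓ (lam * r))‖ₑ ^ 2 := by rw [setLIntegral_const, hvol, mul_comm]
      _ ≤ ∫⁻ u in I, (2 * ‖g (ℓ u)‖ₑ ^ 2 + 2 * B ^ 2) :=
          setLIntegral_mono' measurableSet_Ioc fun u hu =>
            (pow_le_pow_left' (hseg u hu) 2).trans (add_sq_le_two_mul _ _)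
      _ = 2 * (∫⁻ u in I, ‖g (ℓ u)‖ₑ ^ 2) + ENNReal.ofReal r * (2 * B ^ 2) := by
          rw [lintegral_add_right _ measurable_const, setLIntegral_const, hvol,
            lintegral_const_mul _ (hgm.pow_const 2), mul_comm (2 * B ^ 2)]
      _ ≤ _ := by
          gcongr 2 * (∫⁻ u in I, ‖g (ℓ u)‖ₑ ^ 2) + ?_
          calc ENNReal.ofReal r * (2 * B ^ 2)
              ≤ ENNReal.ofReal r * (2 * (ENNReal.ofReal r *
                  ∫⁻ u in I, ‖fderiv ℝ g (ℓ u)‖ₑ ^ 2)) := by gcongr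
            _ = _ := by ring
  have hnorm : ∀ u ∈ I, 2 * (‖g (ℓ u)‖ₑ ^ 2 / ENNReal.ofReal r ^ 2) ≤
      10 * (‖g (ℓ u)‖ₑ ^ 2 / ‖ℓ u‖ₑ ^ 2) := by
    intro u hu
    have hlr : 0 ≤ lam * r := by positivity
    have hu0 : 0 < u := hlr.trans_lt hu.1
    have hur : u ≤ 2 * r := by
      have := hu.2
      nlinarith
    have hx : ‖ℓ u‖ ^ 2 ≤ 5 * r ^ 2 := by
      rw [WithLp.prod_norm_sq_eq_of_L2]
      simp only [hℓ, Real.norm_eq_abs, sq_abs]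
      change ‖w‖ ^ 2 + u ^ 2 ≤ _
      rw [← hr]
      nlinarith
    have hx' : ‖ℓ u‖ₑ ^ 2 ≤ 5 * ENNReal.ofReal r ^ 2 := by
      rw [← ofReal_norm, ← ENNReal.ofReal_pow (norm_nonneg _),
        ← ENNReal.ofReal_pow hrpos.le]
      calc ENNReal.ofReal (‖ℓ u‖ ^ 2) ≤ ENNReal.ofReal (5 * r ^ 2) := ENNReal.ofReal_le_ofReal hx
        _ = _ := by rw [ENNReal.ofReal_mul (by norm_num)]; norm_num
    calc 2 * (‖g (ℓ u)‖ₑ ^ 2 / ENNReal.ofReal r ^ 2)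
        = 10 * (‖g (ℓ u)‖ₑ ^ 2 / (5 * ENNReal.ofReal r ^ 2)) := by
          rw [div_eq_mul_inv, div_eq_mul_inv, ENNReal.mul_inv (by simp) (by simp),
            show (10 : ℝ≥0∞) = 2 * 5 by norm_num,
            show 2 * 5 * (‖g (ℓ u)‖ₑ ^ 2 * (5⁻¹ * (ENNReal.ofReal r ^ 2)⁻¹)) =
              2 * (5 * 5⁻¹) * (‖g (ℓ u)‖ₑ ^ 2 * (ENNReal.ofReal r ^ 2)⁻¹) by ring,
            ENNReal.mul_inv_cancel (by norm_num) (by norm_num), mul_one]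
      _ ≤ _ := by gcongr
  have hr2 : ENNReal.ofReal r * (ENNReal.ofReal r)⁻¹ = 1 := ENNReal.mul_inv_cancel hr0 hrt
  calc ‖g (ℓ (lam * r))‖ₑ ^ 2 / ‖w‖ₑ
      = ENNReal.ofReal r * ‖g (ℓ (lam * r))‖ₑ ^ 2 * ((ENNReal.ofReal r)⁻¹ * (ENNReal.ofReal r)⁻¹) := by
        rw [hwr, div_eq_mul_inv]
        calc _ = 1 * (‖g (ℓ (lam * r))‖ₑ ^ 2 * (ENNReal.ofReal r)⁻¹) := (one_mul _).symm
          _ = _ := by rw [← hr2]; ring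
    _ ≤ (2 * (∫⁻ u in I, ‖g (ℓ u)‖ₑ ^ 2) +
        2 * (ENNReal.ofReal r * ENNReal.ofReal r * ∫⁻ u in I, ‖fderiv ℝ g (ℓ u)‖ₑ ^ 2)) *
          ((ENNReal.ofReal r)⁻¹ * (ENNReal.ofReal r)⁻¹) := mul_le_mul_left hint _
    _ = (∫⁻ u in I, 2 * (‖g (ℓ u)‖ₑ ^ 2 / ENNReal.ofReal r ^ 2)) +
        ∫⁻ u in I, 2 * ‖fderiv ℝ g (ℓ u)‖ₑ ^ 2 := by
        simp_rw [div_eq_mul_inv, ← mul_assoc]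
        rw [lintegral_mul_const _ ((hgm.pow_const 2).const_mul 2),
          lintegral_const_mul _ (hgm.pow_const 2), lintegral_const_mul _ (hDm.pow_const 2)]
        rw [add_mul, add_mul, sq (ENNReal.ofReal r), ENNReal.mul_inv (Or.inl hr0) (Or.inl hrt)]
        congr 1
        · ring
        · calc _ = 2 * (∫⁻ u in I, ‖fderiv ℝ g (ℓ u)‖ₑ ^ 2) *
              (ENNReal.ofReal r * (ENNReal.ofReal r)⁻¹) * (ENNReal.ofReal r * (ENNReal.ofReal r)⁻¹) := by
                ring
            _ = _ := by rw [hr2, mul_one, mul_one]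
    _ ≤ (∫⁻ u in I, 10 * (‖g (ℓ u)‖ₑ ^ 2 / ‖ℓ u‖ₑ ^ 2)) +
        ∫⁻ u in I, 2 * ‖fderiv ℝ g (ℓ u)‖ₑ ^ 2 := by
        gcongr ?_ + _
        exact setLIntegral_mono' measurableSet_Ioc hnorm
    _ = ∫⁻ u in I, (10 * (‖g (ℓ u)‖ₑ ^ 2 / ‖ℓ u‖ₑ ^ 2) + 2 * ‖fderiv ℝ g (ℓ u)‖ₑ ^ 2) :=
        (lintegral_add_right _ ((hDm.pow_const 2).const_mul 2)).symm
    _ ≤ _ := lintegral_mono_set Ioc_subset_Ioi_self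

/-- The trace inequality on the boundary of a cone, in Hardy form. -/
theorem trace_inequality (hd : 2 ≤ finrank ℝ W) {lam : ℝ} (hlam : 0 ≤ lam) (hlam1 : lam ≤ 1)
    {g : WithLp 2 (W × ℝ) → ℝ} {K : ℝ≥0} (hg : LipschitzWith K g) {R : ℝ}
    (hR : ∀ x ∈ solidCone W lam, R ≤ ‖x‖ → g x = 0) :
    ∫⁻ w : W, ‖g (WithLp.toLp 2 (w, lam * ‖w‖))‖ₑ ^ 2 / ‖w‖ₑ ≤
      42 * ∫⁻ x in solidCone W lam, ‖fderiv ℝ g x‖ₑ ^ 2 := by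
  have hfr : finrank ℝ (WithLp 2 (W × ℝ)) = finrank ℝ W + 1 := by
    rw [(WithLp.linearEquiv 2 ℝ (W × ℝ)).finrank_eq, finrank_prod, finrank_self]
  have : Nontrivial W := nontrivial_of_finrank_pos (R := ℝ) (by omega)
  have hardy := hardy_inequality (by omega) (isOpen_solidCone lam).measurableSet
    (zero_notMem_solidCone (W := W) lam)
    (fun s hs x hx => smul_mem_solidCone (one_pos.trans_le hs) hx) hg hR
  have hG : Measurable fun x => ‖fderiv ℝ g x‖ₑ ^ 2 := (measurable_fderiv ℝ g).enorm.pow_const 2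
  have hQ : Measurable fun x => ‖g x‖ₑ ^ 2 / ‖x‖ₑ ^ 2 :=
    (hg.continuous.measurable.enorm.pow_const 2).div (measurable_enorm.pow_const 2)
  calc ∫⁻ w : W, ‖g (WithLp.toLp 2 (w, lam * ‖w‖))‖ₑ ^ 2 / ‖w‖ₑ
      ≤ ∫⁻ w : W, ∫⁻ u in Ioi (lam * ‖w‖), (10 * (‖g (WithLp.toLp 2 (w, u))‖ₑ ^ 2 /
        ‖(WithLp.toLp 2 (w, u) : WithLp 2 (W × ℝ))‖ₑ ^ 2) +
          2 * ‖fderiv ℝ g (WithLp.toLp 2 (w, u))‖ₑ ^ 2) := by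
        refine lintegral_mono_ae ?_
        filter_upwards [ae_ae_toLp_of_ae hg.ae_differentiableAt,
          compl_mem_ae_iff.2 (measure_singleton (0 : W))] with w hw hw0
        exact vertical_trace_le hlam hlam1 hg hw0 hw
    _ = ∫⁻ x in solidCone W lam, (10 * (‖g x‖ₑ ^ 2 / ‖x‖ₑ ^ 2) + 2 * ‖fderiv ℝ g x‖ₑ ^ 2) :=
        (lintegral_solidCone ((hQ.const_mul 10).add (hG.const_mul 2))).symm
    _ = 10 * (∫⁻ x in solidCone W lam, ‖g x‖ₑ ^ 2 / ‖x‖ₑ ^ 2) +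
          2 * ∫⁻ x in solidCone W lam, ‖fderiv ℝ g x‖ₑ ^ 2 := by
        rw [lintegral_add_right _ (hG.const_mul 2), lintegral_const_mul _ hQ,
          lintegral_const_mul _ hG]
    -- Hardy's inequality absorbs the zeroth-order term: `10 · 4 + 2 = 42`.
    _ ≤ 10 * (4 * ∫⁻ x in solidCone W lam, ‖fderiv ℝ g x‖ₑ ^ 2) +
          2 * ∫⁻ x in solidCone W lam, ‖fderiv ℝ g x‖ₑ ^ 2 := by gcongr
    _ = _ := by ring

end Trace

/-! ### The deformation in split coordinates and its differential. -/

section Tilt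

/-- Elementary bounds for the Jacobian `√((1 + k)² + |b - (β b(e)) p|²)`, `k = α b(e)`. -/
theorem jacobian_bounds {E : Type*} [NormedAddCommGroup E] [NormedSpace ℝ E] {e : E}
    {b p : E →L[ℝ] ℝ} {α β lam : ℝ} (he : ‖e‖ ≤ 1) (hp : ‖p‖ ≤ 1) (hα : |α| ≤ lam) (hβ : |β| ≤ lam)
    (hlam : lam ≤ 1 / 4) (hb : ‖b‖ ≤ 1 / 2) :
    |α * b e| ≤ 1 / 4 ∧
    1 + α * b e + ‖b‖ ^ 2 / 8 ≤ √((1 + α * b e) ^ 2 + ‖b - (β * b e) • p‖ ^ 2) ∧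
      √((1 + α * b e) ^ 2 + ‖b - (β * b e) • p‖ ^ 2) ≤ 1 + α * b e + 4 * ‖b‖ ^ 2 := by
  have hlam0 : 0 ≤ lam := (abs_nonneg _).trans hα
  have hbe : |b e| ≤ ‖b‖ := by
    calc |b e| ≤ ‖b‖ * ‖e‖ := b.le_opNorm e
      _ ≤ ‖b‖ := mul_le_of_le_one_right (norm_nonneg _) he
  have hk : |α * b e| ≤ 1 / 4 := by
    rw [abs_mul]
    nlinarith [abs_nonneg α, abs_nonneg (b e)]
  have hbp : ‖(β * b e) • p‖ ≤ ‖b‖ / 4 := by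
    rw [norm_smul, Real.norm_eq_abs, abs_mul]
    have h1 : |β| * |b e| ≤ 1 / 4 * ‖b‖ := by
      refine mul_le_mul (hβ.trans hlam) hbe (abs_nonneg _) (by norm_num)
    nlinarith [norm_nonneg p, norm_nonneg b]
  set k := α * b e
  set q := ‖b - (β * b e) • p‖
  have hq1 : 3 / 4 * ‖b‖ ≤ q := by
    have := norm_sub_norm_le b ((β * b e) • p)
    linarith
  have hq2 : q ≤ 5 / 4 * ‖b‖ := by
    have := norm_sub_le b ((β * b e) • p)
    linarith
  have hb0 := norm_nonneg b
  have hq0 : 0 ≤ q := norm_nonneg _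
  obtain ⟨hk1, hk2⟩ := abs_le.1 hk
  have hqq : q ^ 2 ≤ 25 / 16 * ‖b‖ ^ 2 := by nlinarith
  have hqq' : 9 / 16 * ‖b‖ ^ 2 ≤ q ^ 2 := by nlinarith
  have hbb : ‖b‖ ^ 2 ≤ 1 / 4 := by nlinarith
  refine ⟨hk, ?_, ?_⟩
  -- Comparing squares cancels `(1 + k)²` exactly, so `k` is kept without error. What remains
  -- compares multiples of `‖b‖²`, using `3/4 ‖b‖ ≤ q ≤ 5/4 ‖b‖` and `3/4 ≤ 1 + k ≤ 5/4`.
  · refine Real.le_sqrt_of_sq_le ?_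
    nlinarith [sq_nonneg (‖b‖ ^ 2), mul_nonneg (sq_nonneg ‖b‖) (sub_nonneg.2 hk2),
      mul_nonneg (sq_nonneg ‖b‖) (sub_nonneg.2 hbb)]
  · rw [Real.sqrt_le_left (by nlinarith)]
    nlinarith [sq_nonneg (‖b‖ ^ 2), mul_nonneg (sq_nonneg ‖b‖) (sub_nonneg.2 hk1)]

variable {W : Type*} [NormedAddCommGroup W] [InnerProductSpace ℝ W]

/-- The unit vector along the axis of the cone. -/
def axisVector (W : Type*) [NormedAddCommGroup W] : WithLp 2 (W × ℝ) := WithLp.toLp 2 (0, 1)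

omit [InnerProductSpace ℝ W] in
theorem norm_axisVector : ‖axisVector W‖ = 1 := by
  rw [axisVector, WithLp.prod_norm_eq_of_L2]
  simp

/-- The vertical displacement `λ (√(|x'|² + v²) - |x'|)`. -/
def lift (lam : ℝ) (v : WithLp 2 (W × ℝ) → ℝ) (x : WithLp 2 (W × ℝ)) : ℝ :=
  lam * (√(‖x.fst‖ ^ 2 + v x ^ 2) - ‖x.fst‖)

/-- The flow `Φ[v]` in the coordinates `((x', x_n), x_{n+1})`. -/
def tilt (lam : ℝ) (v : WithLp 2 (W × ℝ) → ℝ) (x : WithLp 2 (W × ℝ)) :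
    WithLp 2 (WithLp 2 (W × ℝ) × ℝ) :=
  WithLp.toLp 2 (x + lift lam v x • axisVector W, v x)

/-- The coefficient `λ v / √(|x'|² + v²)`. -/
def slope (lam : ℝ) (v : WithLp 2 (W × ℝ) → ℝ) (x : WithLp 2 (W × ℝ)) : ℝ :=
  lam * (v x / √(‖x.fst‖ ^ 2 + v x ^ 2))

/-- The coefficient `λ (|x'| / √(|x'|² + v²) - 1)`. -/
def radialSlope (lam : ℝ) (v : WithLp 2 (W × ℝ) → ℝ) (x : WithLp 2 (W × ℝ)) : ℝ :=
  lam * (‖x.fst‖ / √(‖x.fst‖ ^ 2 + v x ^ 2) - 1)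

/-- The differential of `x ↦ |x'|`. -/
def radial (x : WithLp 2 (W × ℝ)) : WithLp 2 (W × ℝ) →L[ℝ] ℝ :=
  ‖x.fst‖⁻¹ • (innerSL ℝ x.fst).comp (WithLp.fstL 2 ℝ W ℝ)

theorem radial_axisVector (x : WithLp 2 (W × ℝ)) : radial x (axisVector W) = 0 := by
  simp [radial, axisVector]

omit [InnerProductSpace ℝ W] in
theorem norm_fst_le (x : WithLp 2 (W × ℝ)) : ‖x.fst‖ ≤ ‖x‖ := by
  refine (sq_le_sq₀ (norm_nonneg _) (norm_nonneg _)).1 ?_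
  rw [WithLp.prod_norm_sq_eq_of_L2]
  exact le_add_of_nonneg_right (sq_nonneg _)

theorem norm_radial_le (x : WithLp 2 (W × ℝ)) : ‖radial x‖ ≤ 1 := by
  refine ContinuousLinearMap.opNorm_le_bound _ zero_le_one fun y => ?_
  have h : ‖inner ℝ x.fst y.fst‖ ≤ ‖x.fst‖ * ‖y‖ :=
    (norm_inner_le_norm _ _).trans (by gcongr; exact norm_fst_le y)
  rw [one_mul]
  calc ‖radial x y‖ = ‖x.fst‖⁻¹ * ‖inner ℝ x.fst y.fst‖ := by
        simp [radial]
    _ ≤ ‖x.fst‖⁻¹ * (‖x.fst‖ * ‖y‖) := by gcongr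
    _ ≤ ‖y‖ := by
        rw [← mul_assoc]
        exact mul_le_of_le_one_left (norm_nonneg _) inv_mul_le_one

omit [InnerProductSpace ℝ W] in
theorem abs_slope_le {lam : ℝ} (hlam : 0 ≤ lam) (v : WithLp 2 (W × ℝ) → ℝ)
    (x : WithLp 2 (W × ℝ)) : |slope lam v x| ≤ lam := by
  rw [slope, abs_mul, abs_of_nonneg hlam, abs_div, abs_of_nonneg (Real.sqrt_nonneg _)]
  refine mul_le_of_le_one_right hlam (div_le_one_of_le₀ ?_ (Real.sqrt_nonneg _))
  exact Real.abs_le_sqrt (le_add_of_nonneg_left (sq_nonneg _))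

omit [InnerProductSpace ℝ W] in
theorem abs_radialSlope_le {lam : ℝ} (hlam : 0 ≤ lam) (v : WithLp 2 (W × ℝ) → ℝ)
    (x : WithLp 2 (W × ℝ)) : |radialSlope lam v x| ≤ lam := by
  have h1 : ‖x.fst‖ / √(‖x.fst‖ ^ 2 + v x ^ 2) ≤ 1 := by
    refine div_le_one_of_le₀ (Real.le_sqrt_of_sq_le ?_) (Real.sqrt_nonneg _)
    exact le_add_of_nonneg_right (sq_nonneg _)
  have h0 : 0 ≤ ‖x.fst‖ / √(‖x.fst‖ ^ 2 + v x ^ 2) := by positivity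
  rw [radialSlope, abs_mul, abs_of_nonneg hlam]
  refine mul_le_of_le_one_right hlam ?_
  rw [abs_le]
  constructor <;> linarith

theorem hasFDerivAt_lift {lam : ℝ} {v : WithLp 2 (W × ℝ) → ℝ} {b : WithLp 2 (W × ℝ) →L[ℝ] ℝ}
    {x : WithLp 2 (W × ℝ)} (hv : HasFDerivAt v b x) (hx : x.fst ≠ 0) :
    HasFDerivAt (lift lam v) (slope lam v x • b + radialSlope lam v x • radial x) x := by
  have hr : 0 < ‖x.fst‖ := norm_pos_iff.2 hx
  have hfst : HasFDerivAt (fun y : WithLp 2 (W × ℝ) => y.fst) (WithLp.fstL 2 ℝ W ℝ) x :=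
    (WithLp.fstL 2 ℝ W ℝ).hasFDerivAt
  have h1 := hfst.norm_sq
  have hpos : 0 < ‖x.fst‖ ^ 2 + v x ^ 2 := by positivity
  have h2 := (h1.add (hv.pow 2)).sqrt hpos.ne'
  have h3 := h1.sqrt (by positivity)
  have h4 := (h2.sub h3).const_mul lam
  have h5 : HasFDerivAt (lift lam v) _ x := h4.congr_of_eventuallyEq
    (Eventually.of_forall fun y => by simp [lift, Real.sqrt_sq])
  refine h5.congr_fderiv ?_
  ext ξ
  have hρ : 0 < √(‖x.fst‖ ^ 2 + v x ^ 2) := Real.sqrt_pos.2 hpos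
  simp [slope, radialSlope, radial, Real.sqrt_sq]
  field_simp
  ring

theorem hasFDerivAt_tilt {lam : ℝ} {v : WithLp 2 (W × ℝ) → ℝ} {b : WithLp 2 (W × ℝ) →L[ℝ] ℝ}
    {x : WithLp 2 (W × ℝ)} (hv : HasFDerivAt v b x) (hx : x.fst ≠ 0) :
    HasFDerivAt (tilt lam v)
      (shearGraph (axisVector W) (slope lam v x • b + radialSlope lam v x • radial x) b) x := by
  have h := ((hasFDerivAt_id x).add
    ((hasFDerivAt_lift (lam := lam) hv hx).smul_const (axisVector W))).prodMk hv
  exact (WithLp.prodContinuousLinearEquiv 2 ℝ (WithLp 2 (W × ℝ)) ℝ).symm.hasFDerivAt.comp x h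

omit [InnerProductSpace ℝ W] in
-- The square root is the Euclidean norm of `(x', v x)`, so `lift` is a multiple of a difference of
-- Lipschitz functions, even across the axis where it may fail to be differentiable.
theorem exists_lipschitzWith_lift (lam : ℝ) {v : WithLp 2 (W × ℝ) → ℝ} {K : ℝ≥0}
    (hv : LipschitzWith K v) : ∃ K', LipschitzWith K' (lift lam v) := by
  have h1 : LipschitzWith 1 fun x : WithLp 2 (W × ℝ) => x.fst :=
    LipschitzWith.of_dist_le_mul fun x y => by
      simpa [dist_eq_norm] using norm_fst_le (x - y)
  have h2 := (WithLp.prod_lipschitzWith_toLp 2 W ℝ).comp (h1.prodMk hv)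
  have h3 := lipschitzWith_one_norm.comp h2
  have h4 := lipschitzWith_one_norm.comp h1
  have h5 := (lipschitzWith_smul lam).comp (h3.sub h4)
  have heq : lift lam v = (fun y : ℝ => lam • y) ∘ fun x =>
      ((norm ∘ WithLp.toLp 2 ∘ fun x => (x.fst, v x)) x - (norm ∘ fun x => x.fst) x) := by
    ext x
    simp [lift, WithLp.prod_norm_eq_of_L2]
  exact ⟨_, heq ▸ h5⟩

theorem exists_lipschitzWith_tilt (lam : ℝ) {v : WithLp 2 (W × ℝ) → ℝ} {K : ℝ≥0}
    (hv : LipschitzWith K v) : ∃ K', LipschitzWith K' (tilt lam v) := by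
  obtain ⟨K', hK'⟩ := exists_lipschitzWith_lift lam hv
  have h1 : LipschitzWith (K' * ‖axisVector W‖₊) fun x => lift lam v x • axisVector W :=
    LipschitzWith.of_dist_le_mul fun x y => by
      rw [dist_eq_norm, ← sub_smul, norm_smul, NNReal.coe_mul, coe_nnnorm]
      have := hK'.dist_le_mul x y
      rw [dist_eq_norm] at this
      calc _ ≤ K' * dist x y * ‖axisVector W‖ := by gcongr
        _ = _ := by ring
  exact ⟨_, (WithLp.prod_lipschitzWith_toLp 2 _ ℝ).comp ((LipschitzWith.id.add h1).prodMk hv)⟩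

/-- The image point reveals `v x` and `x'`, and these determine the vertical displacement, which can
then be undone. No smallness or regularity of `v` enters. -/
theorem injective_tilt (lam : ℝ) (v : WithLp 2 (W × ℝ) → ℝ) : Injective (tilt lam v) := by
  intro x y h
  have h1 : x + lift lam v x • axisVector W = y + lift lam v y • axisVector W :=
    congrArg (fun z => z.fst) h
  have h2 : v x = v y := congrArg (fun z => z.snd) h
  have h3 : x.fst = y.fst := by
    have := congrArg (fun z => z.fst) h1
    simpa [axisVector] using this
  have h4 : lift lam v x = lift lam v y := by rw [lift, lift, h2, h3]
  rw [h4] at h1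
  exact add_right_cancel h1

end Tilt

/-! ### The first-order term as a boundary integral. -/

section FirstOrder

variable {W : Type*} [NormedAddCommGroup W] [InnerProductSpace ℝ W]

/-- The vertical derivative of `lift`. -/
def verticalRate (lam : ℝ) (v : WithLp 2 (W × ℝ) → ℝ) (x : WithLp 2 (W × ℝ)) : ℝ :=
  slope lam v x * fderiv ℝ v x (axisVector W)

theorem abs_verticalRate_le {lam : ℝ} (hlam : 0 ≤ lam) {v : WithLp 2 (W × ℝ) → ℝ} {K : ℝ≥0}
    (hv : LipschitzWith K v) (x : WithLp 2 (W × ℝ)) : |verticalRate lam v x| ≤ lam * K := by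
  rw [verticalRate, abs_mul]
  refine mul_le_mul (abs_slope_le hlam v x) ?_ (abs_nonneg _) hlam
  calc |fderiv ℝ v x (axisVector W)| ≤ ‖fderiv ℝ v x‖ * ‖axisVector W‖ :=
        (fderiv ℝ v x).le_opNorm _
    _ ≤ K := by rw [norm_axisVector, mul_one]; exact norm_fderiv_le_of_lipschitz ℝ hv

omit [InnerProductSpace ℝ W] in
theorem lift_eq_zero {lam : ℝ} {v : WithLp 2 (W × ℝ) → ℝ} {x : WithLp 2 (W × ℝ)} (h : v x = 0) :
    lift lam v x = 0 := by
  simp [lift, h, Real.sqrt_sq]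

theorem verticalRate_eq_zero {lam : ℝ} {v : WithLp 2 (W × ℝ) → ℝ} {x : WithLp 2 (W × ℝ)}
    (h : v x = 0) : verticalRate lam v x = 0 := by
  simp [verticalRate, slope, h]

theorem hasDerivAt_toLp_prodMk (w : W) (u : ℝ) :
    HasDerivAt (fun u : ℝ => WithLp.toLp 2 (w, u)) (axisVector W) u := by
  have h0 : HasDerivAt (fun u : ℝ => ((w, u) : W × ℝ)) (0, 1) u :=
    (hasDerivAt_const u w).prodMk (hasDerivAt_id u)
  exact (WithLp.prodContinuousLinearEquiv 2 ℝ W ℝ).symm.hasFDerivAt.comp_hasDerivAt u h0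

/-- The radial part of the differential of `lift` does not see the axis, so `verticalRate` is its
derivative along the line. The fundamental theorem of calculus leaves only the endpoint on the
boundary of the cone. -/
theorem integral_verticalRate_line {lam : ℝ} (hlam : 0 ≤ lam) {v : WithLp 2 (W × ℝ) → ℝ}
    {K : ℝ≥0} (hv : LipschitzWith K v) {R : ℝ} (hR : ∀ x ∈ solidCone W lam, R ≤ ‖x‖ → v x = 0)
    {w : W} (hw : w ≠ 0) (hdiff : ∀ᵐ u : ℝ, DifferentiableAt ℝ v (WithLp.toLp 2 (w, u))) :
    ∫ u in Ioi (lam * ‖w‖), verticalRate lam v (WithLp.toLp 2 (w, u)) =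
      -lift lam v (WithLp.toLp 2 (w, lam * ‖w‖)) := by
  set a := lam * ‖w‖ with ha
  have ha0 : 0 ≤ a := by positivity
  -- At heights from `b` on, the norm exceeds `R`, so `v` vanishes.
  set b := a + (|R| + 1) with hb
  have hab : a < b := by
    have := abs_nonneg R
    linarith
  have hvan : ∀ u, b ≤ u → v (WithLp.toLp 2 (w, u)) = 0 := by
    intro u hu
    refine hR _ (show lam * ‖w‖ < u from hab.trans_le hu) ?_
    have h1 : ‖u‖ ≤ ‖(WithLp.toLp 2 (w, u) : WithLp 2 (W × ℝ))‖ := by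
      refine (sq_le_sq₀ (norm_nonneg _) (norm_nonneg _)).1 ?_
      rw [WithLp.prod_norm_sq_eq_of_L2]
      exact le_add_of_nonneg_left (sq_nonneg _)
    have := le_abs_self R
    have := le_abs_self u
    rw [Real.norm_eq_abs] at h1
    linarith
  obtain ⟨K', hK'⟩ := exists_lipschitzWith_lift lam hv
  have hφ := hK'.comp (isometry_toLp_prodMk w).lipschitz
  have hftc := (hφ.lipschitzOnWith
    (s := uIcc a b)).absolutelyContinuousOnInterval.integral_deriv_eq_sub
  rw [intervalIntegral.integral_of_le hab.le] at hftc
  have h1 : ∫ u in Ioi a, verticalRate lam v (WithLp.toLp 2 (w, u)) =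
      ∫ u in Ioc a b, verticalRate lam v (WithLp.toLp 2 (w, u)) := by
    refine setIntegral_eq_of_subset_of_forall_sdiff_eq_zero measurableSet_Ioi
      Ioc_subset_Ioi_self fun u hu => verticalRate_eq_zero (hvan u ?_)
    by_contra h
    exact hu.2 ⟨hu.1, (not_le.1 h).le⟩
  rw [h1]
  have h2 : ∫ u in Ioc a b, verticalRate lam v (WithLp.toLp 2 (w, u)) =
      ∫ u in Ioc a b, deriv (lift lam v ∘ fun u : ℝ => WithLp.toLp 2 (w, u)) u := by
    refine integral_congr_ae ?_
    filter_upwards [ae_restrict_of_ae hdiff] with u hu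
    have hder := (hasFDerivAt_lift (lam := lam) (x := WithLp.toLp 2 (w, u)) hu.hasFDerivAt
      hw).comp_hasDerivAt u (hasDerivAt_toLp_prodMk w u)
    rw [hder.deriv]
    simp [verticalRate, radial_axisVector]
  rw [h2, hftc]
  simp only [comp_apply]
  rw [lift_eq_zero (hvan b le_rfl), zero_sub]

omit [InnerProductSpace ℝ W] in
theorem lift_nonneg {lam : ℝ} (hlam : 0 ≤ lam) (v : WithLp 2 (W × ℝ) → ℝ) (x : WithLp 2 (W × ℝ)) :
    0 ≤ lift lam v x := by
  refine mul_nonneg hlam (sub_nonneg.2 (Real.le_sqrt_of_sq_le ?_))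
  exact le_add_of_nonneg_right (sq_nonneg _)

omit [InnerProductSpace ℝ W] in
theorem lift_le {lam : ℝ} (hlam : 0 ≤ lam) (v : WithLp 2 (W × ℝ) → ℝ) {x : WithLp 2 (W × ℝ)}
    (hx : x.fst ≠ 0) : lift lam v x ≤ lam / 2 * (v x ^ 2 / ‖x.fst‖) := by
  have hr : 0 < ‖x.fst‖ := norm_pos_iff.2 hx
  have h : √(‖x.fst‖ ^ 2 + v x ^ 2) ≤ ‖x.fst‖ + v x ^ 2 / ‖x.fst‖ / 2 := by
    rw [Real.sqrt_le_left (by positivity)]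
    have : (‖x.fst‖ + v x ^ 2 / ‖x.fst‖ / 2) ^ 2 =
        ‖x.fst‖ ^ 2 + v x ^ 2 + (v x ^ 2 / ‖x.fst‖ / 2) ^ 2 := by
      field_simp
      ring
    rw [this]
    exact le_add_of_nonneg_right (sq_nonneg _)
  calc lift lam v x ≤ lam * (v x ^ 2 / ‖x.fst‖ / 2) := by
        rw [lift]
        gcongr
        linarith
    _ = _ := by ring

variable [FiniteDimensional ℝ W] [MeasurableSpace W] [BorelSpace W]

omit [InnerProductSpace ℝ W] [FiniteDimensional ℝ W] in
theorem measurable_slope [SecondCountableTopology W] (lam : ℝ) {v : WithLp 2 (W × ℝ) → ℝ} (hv : Measurable v) :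
    Measurable (slope lam v) := by
  have h : Measurable fun x : WithLp 2 (W × ℝ) => ‖x.fst‖ :=
    (show Continuous fun x : WithLp 2 (W × ℝ) => ‖x.fst‖ by fun_prop).measurable
  exact (hv.div ((h.pow_const 2).add (hv.pow_const 2)).sqrt).const_mul lam

omit [InnerProductSpace ℝ W] [FiniteDimensional ℝ W] in
theorem measurable_radialSlope [SecondCountableTopology W] (lam : ℝ) {v : WithLp 2 (W × ℝ) → ℝ} (hv : Measurable v) :
    Measurable (radialSlope lam v) := by
  have h : Measurable fun x : WithLp 2 (W × ℝ) => ‖x.fst‖ :=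
    (show Continuous fun x : WithLp 2 (W × ℝ) => ‖x.fst‖ by fun_prop).measurable
  exact ((h.div ((h.pow_const 2).add (hv.pow_const 2)).sqrt).sub_const 1).const_mul lam

theorem measurable_radial : Measurable (radial : WithLp 2 (W × ℝ) → _) := by
  have h : Measurable fun x : WithLp 2 (W × ℝ) => ‖x.fst‖ :=
    (show Continuous fun x : WithLp 2 (W × ℝ) => ‖x.fst‖ by fun_prop).measurable
  have h2 : Continuous fun x : WithLp 2 (W × ℝ) =>
      (innerSL ℝ x.fst).comp (WithLp.fstL 2 ℝ W ℝ) := by fun_prop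
  exact h.inv.smul h2.measurable

theorem measurable_verticalRate (lam : ℝ) {v : WithLp 2 (W × ℝ) → ℝ} (hv : Measurable v) :
    Measurable (verticalRate lam v) :=
  (measurable_slope lam hv).mul (measurable_fderiv_apply_const ℝ v _)

/-- Fubini over vertical lines. Integrability holds because the rate is bounded by `λK` and vanishes
on the cone outside a ball; the line over `w = 0` is negligible since `W` is nontrivial. -/
theorem integral_verticalRate_solidCone {lam : ℝ} (hlam : 0 ≤ lam) {v : WithLp 2 (W × ℝ) → ℝ}
    {K : ℝ≥0} (hv : LipschitzWith K v) {R : ℝ} (hR : ∀ x ∈ solidCone W lam, R ≤ ‖x‖ → v x = 0)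
    [Nontrivial W] :
    IntegrableOn (verticalRate lam v) (solidCone W lam) ∧
    ∫ x in solidCone W lam, verticalRate lam v x =
      -∫ w : W, lift lam v (WithLp.toLp 2 (w, lam * ‖w‖)) := by
  have hm : MeasurableSet (solidCone W lam) := (isOpen_solidCone lam).measurableSet
  have hmk := measurable_verticalRate lam hv.continuous.measurable
  have hint : IntegrableOn (verticalRate lam v) (solidCone W lam) := by
    have hball : IntegrableOn (verticalRate lam v) (solidCone W lam ∩ Metric.ball 0 R) := by
      refine Measure.integrableOn_of_bounded (M := lam * K) ?_ hmk.aestronglyMeasurable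
        (Eventually.of_forall fun x => abs_verticalRate_le hlam hv x)
      exact (measure_mono inter_subset_right).trans_lt measure_ball_lt_top |>.ne
    refine hball.of_forall_sdiff_eq_zero hm fun x hx => verticalRate_eq_zero (hR x hx.1 ?_)
    by_contra h
    exact hx.2 ⟨hx.1, by simpa using h⟩
  refine ⟨hint, ?_⟩
  have hmp := WithLp.volume_preserving_toLp W ℝ
  have hemb : MeasurableEmbedding (WithLp.toLp 2 : W × ℝ → WithLp 2 (W × ℝ)) :=
    (MeasurableEquiv.toLp 2 (W × ℝ)).measurableEmbedding
  rw [← integral_indicator hm, ← hmp.integral_comp hemb, volume_eq_prod, integral_prod]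
  · rw [← integral_neg]
    refine integral_congr_ae ?_
    filter_upwards [ae_ae_toLp_of_ae hv.ae_differentiableAt,
      compl_mem_ae_iff.2 (measure_singleton (0 : W))] with w hw hw0
    rw [← integral_verticalRate_line hlam hv hR hw0 hw, ← integral_indicator measurableSet_Ioi]
    rfl
  · rw [← volume_eq_prod]
    exact (hmp.integrable_comp_emb hemb).2 ((integrable_indicator_iff hm).2 hint)

/-- The first-order term of the area is controlled by the Dirichlet energy. -/
theorem integral_verticalRate_bounds (hd : 2 ≤ finrank ℝ W) {lam : ℝ} (hlam : 0 ≤ lam)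
    (hlam1 : lam ≤ 1) {v : WithLp 2 (W × ℝ) → ℝ}
    {K : ℝ≥0} (hv : LipschitzWith K v) {R : ℝ} (hR : ∀ x ∈ solidCone W lam, R ≤ ‖x‖ → v x = 0)
    (hfin : ∫⁻ x in solidCone W lam, ‖fderiv ℝ v x‖ₑ ^ 2 ≠ ∞) :
    ∫ x in solidCone W lam, verticalRate lam v x ≤ 0 ∧
    -(21 * lam * (∫⁻ x in solidCone W lam, ‖fderiv ℝ v x‖ₑ ^ 2).toReal) ≤
      ∫ x in solidCone W lam, verticalRate lam v x := by
  have : Nontrivial W := nontrivial_of_finrank_pos (R := ℝ) (by omega)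
  have hnn : ∀ w : W, 0 ≤ lift lam v (WithLp.toLp 2 (w, lam * ‖w‖)) := fun w =>
    lift_nonneg hlam v _
  rw [(integral_verticalRate_solidCone hlam hv hR).2]
  refine ⟨neg_nonpos.2 (integral_nonneg hnn), neg_le_neg ?_⟩
  obtain ⟨K', hK'⟩ := exists_lipschitzWith_lift lam hv
  rw [integral_eq_lintegral_of_nonneg_ae (Eventually.of_forall hnn)
    (hK'.continuous.comp (by fun_prop)).aestronglyMeasurable]
  -- The quadratic bound on `lift` meets the trace inequality: `(λ/2) · 42 = 21 λ`.
  have key : ∫⁻ w : W, ENNReal.ofReal (lift lam v (WithLp.toLp 2 (w, lam * ‖w‖))) ≤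
      ENNReal.ofReal (lam / 2) * (42 * ∫⁻ x in solidCone W lam, ‖fderiv ℝ v x‖ₑ ^ 2) := by
    calc _ ≤ ∫⁻ w : W, ENNReal.ofReal (lam / 2) *
          (‖v (WithLp.toLp 2 (w, lam * ‖w‖))‖ₑ ^ 2 / ‖w‖ₑ) := by
          refine lintegral_mono_ae ?_
          filter_upwards [compl_mem_ae_iff.2 (measure_singleton (0 : W))] with w hw0
          have hw : 0 < ‖w‖ := norm_pos_iff.2 hw0
          refine (ENNReal.ofReal_le_ofReal (lift_le hlam v (x := WithLp.toLp 2 (w, lam * ‖w‖))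
            hw0)).trans (le_of_eq ?_)
          change ENNReal.ofReal (_ * (_ / ‖w‖)) = _
          rw [ENNReal.ofReal_mul (by positivity), ENNReal.ofReal_div_of_pos hw, ← sq_abs,
            ENNReal.ofReal_pow (abs_nonneg _), ← Real.norm_eq_abs, ofReal_norm, ofReal_norm]
      _ = ENNReal.ofReal (lam / 2) *
          ∫⁻ w : W, ‖v (WithLp.toLp 2 (w, lam * ‖w‖))‖ₑ ^ 2 / ‖w‖ₑ :=
          lintegral_const_mul' _ _ ENNReal.ofReal_ne_top
      _ ≤ _ := by
          gcongr
          exact trace_inequality hd hlam hlam1 hv hR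
  have := ENNReal.toReal_mono (ENNReal.mul_ne_top ENNReal.ofReal_ne_top
    (ENNReal.mul_ne_top (by norm_num) hfin)) key
  refine this.trans (le_of_eq ?_)
  rw [ENNReal.toReal_mul, ENNReal.toReal_mul, ENNReal.toReal_ofReal (by positivity)]
  norm_num
  ring

end FirstOrder

/-! ### Two-sided area expansion, and rigidity at zero energy. -/

section AreaExpansion

variable {W : Type*} [NormedAddCommGroup W] [InnerProductSpace ℝ W] [FiniteDimensional ℝ W]
  [MeasurableSpace W] [BorelSpace W]

/-- The Jacobian of `tilt`. -/
def tiltJacobian (lam : ℝ) (v : WithLp 2 (W × ℝ) → ℝ) (x : WithLp 2 (W × ℝ)) : ℝ :=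
  √((1 + verticalRate lam v x) ^ 2 +
    ‖fderiv ℝ v x - (radialSlope lam v x * fderiv ℝ v x (axisVector W)) • radial x‖ ^ 2)

theorem measurable_tiltJacobian (lam : ℝ) {v : WithLp 2 (W × ℝ) → ℝ} (hv : Measurable v) :
    Measurable (tiltJacobian lam v) := by
  have h1 := measurable_verticalRate lam hv
  have h2 := (measurable_fderiv ℝ v).sub
    (((measurable_radialSlope lam hv).mul (measurable_fderiv_apply_const ℝ v (axisVector W))).smul
      measurable_radial)
  exact (((h1.const_add 1).pow_const 2).add (h2.norm.pow_const 2)).sqrt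

omit [FiniteDimensional ℝ W] [MeasurableSpace W] [BorelSpace W] in
theorem tiltJacobian_bounds {lam : ℝ} (hlam : 0 ≤ lam) (hlam1 : lam ≤ 1 / 4)
    {v : WithLp 2 (W × ℝ) → ℝ} {K : ℝ≥0} (hv : LipschitzWith K v) (hK : K ≤ 1 / 2)
    (x : WithLp 2 (W × ℝ)) :
    |verticalRate lam v x| ≤ 1 / 4 ∧
    1 + verticalRate lam v x + ‖fderiv ℝ v x‖ ^ 2 / 8 ≤ tiltJacobian lam v x ∧
      tiltJacobian lam v x ≤ 1 + verticalRate lam v x + 4 * ‖fderiv ℝ v x‖ ^ 2 := by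
  refine jacobian_bounds norm_axisVector.le (norm_radial_le x) (abs_slope_le hlam v x)
    (abs_radialSlope_le hlam v x) hlam1 ?_
  refine (norm_fderiv_le_of_lipschitz ℝ hv).trans ?_
  have : (K : ℝ) ≤ ((1 / 2 : ℝ≥0) : ℝ) := by exact_mod_cast hK
  simpa using this

theorem ofReal_norm_sq {F : Type*} [SeminormedAddCommGroup F] (x : F) :
    ENNReal.ofReal (‖x‖ ^ 2) = ‖x‖ₑ ^ 2 := by
  rw [ENNReal.ofReal_pow (norm_nonneg _), ofReal_norm]

theorem enorm_fderiv_eq_zero {E : Type*} [NormedAddCommGroup E] [NormedSpace ℝ E] {v : E → ℝ}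
    {x : E} (h : v =ᶠ[𝓝 x] 0) : ‖fderiv ℝ v x‖ₑ = 0 := by
  rw [← ofReal_norm, h.fderiv_eq]
  simp

theorem enorm_fderiv_const_mul_sq {E : Type*} [NormedAddCommGroup E] [NormedSpace ℝ E] (t : ℝ)
    (g : E → ℝ) (x : E) :
    ‖fderiv ℝ (fun x => t * g x) x‖ₑ ^ 2 = ENNReal.ofReal (t ^ 2) * ‖fderiv ℝ g x‖ₑ ^ 2 := by
  have h : fderiv ℝ (fun x => t * g x) x = t • fderiv ℝ g x :=
    congrFun (fderiv_const_smul_field (f := g) t) x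
  rw [h, ← ofReal_norm_sq, ← ofReal_norm_sq, norm_smul, mul_pow, Real.norm_eq_abs, sq_abs,
    ENNReal.ofReal_mul (sq_nonneg t)]

theorem ae_fst_ne_zero [Nontrivial W] : ∀ᵐ x : WithLp 2 (W × ℝ), x.fst ≠ 0 := by
  have h1 : QuasiMeasurePreserving (Prod.fst : W × ℝ → W) volume volume :=
    quasiMeasurePreserving_fst
  have h2 := h1.comp (WithLp.volume_preserving_ofLp W ℝ).quasiMeasurePreserving
  exact h2.ae (compl_mem_ae_iff.2 (measure_singleton (0 : W)))

/-- The area formula applies on the full-measure set where `v` is differentiable and `x' ≠ 0`; the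
rest is null, and its image is null because `tilt` is Lipschitz. -/
theorem euclideanHausdorffMeasure_tilt_image [Nontrivial W] {lam : ℝ} (hlam : 0 ≤ lam)
    (hlam1 : lam ≤ 1 / 4) {v : WithLp 2 (W × ℝ) → ℝ} {K : ℝ≥0} (hv : LipschitzWith K v)
    (hK : K ≤ 1 / 2) {S : Set (WithLp 2 (W × ℝ))} (hS : MeasurableSet S) :
    euclideanHausdorffMeasure (finrank ℝ (WithLp 2 (W × ℝ))) (tilt lam v '' S) =
      ∫⁻ x in S, ENNReal.ofReal (tiltJacobian lam v x) := by
  set d := finrank ℝ (WithLp 2 (W × ℝ)) with hd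
  set T : Set (WithLp 2 (W × ℝ)) := {x | DifferentiableAt ℝ v x ∧ x.fst ≠ 0} with hT
  have hTm : MeasurableSet T :=
    (measurableSet_of_differentiableAt ℝ v).inter
      (isOpen_ne_fun (by fun_prop) continuous_const).measurableSet
  have hTae : volume Tᶜ = 0 := by
    have : ∀ᵐ x, x ∈ T := hv.ae_differentiableAt.and ae_fst_ne_zero
    exact this
  have hnull : euclideanHausdorffMeasure d (tilt lam v '' (S \ T)) = 0 := by
    obtain ⟨K', hK'⟩ := exists_lipschitzWith_tilt lam hv
    have h0 : volume (S \ T) = 0 := measure_mono_null (fun x hx => hx.2) hTae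
    have := euclideanHausdorffMeasure_image_le_of_edist_le (f := tilt lam v) (g := id)
      (s := S \ T) d fun x _ y _ => hK' x y
    rw [image_id, hd, InnerProductSpace.euclideanHausdorffMeasure_eq_volume, h0, mul_zero] at this
    exact le_antisymm this zero_le
  have hkey : ∀ x ∈ S ∩ T, 0 < 1 + (slope lam v x • fderiv ℝ v x +
      radialSlope lam v x • radial x) (axisVector W) := by
    intro x _
    have := (abs_le.1 (tiltJacobian_bounds hlam hlam1 hv hK x).1).1
    have h : (slope lam v x • fderiv ℝ v x + radialSlope lam v x • radial x) (axisVector W) =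
        verticalRate lam v x := by
      simp [verticalRate, radial_axisVector]
    rw [h]
    linarith
  have hmain := euclideanHausdorffMeasure_image_eq_lintegral (hS.inter hTm)
    (F := tilt lam v) (J := tiltJacobian lam v)
    (fun x hx => (hasFDerivAt_tilt hx.2.1.hasFDerivAt hx.2.2).hasFDerivWithinAt)
    (injective_tilt lam v).injOn (fun x hx => injective_shearGraph _ _ _ (hkey x hx))
    (measurable_tiltJacobian lam hv.continuous.measurable)
    (fun x hx => by
      rw [normDet_shearGraph _ _ _ (hkey x hx),
        norm_shear_tilt _ _ _ _ _ (radial_axisVector x)]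
      simp [tiltJacobian, verticalRate, radial_axisVector])
  have himg : euclideanHausdorffMeasure d (tilt lam v '' S) =
      euclideanHausdorffMeasure d (tilt lam v '' (S ∩ T)) := by
    refine le_antisymm ?_ (measure_mono (image_mono inter_subset_left))
    rw [← inter_union_sdiff S T, image_union]
    refine (measure_union_le _ _).trans ?_
    rw [hnull, add_zero, inter_union_sdiff]
  rw [himg, hmain]
  refine setLIntegral_congr ?_
  exact inter_ae_eq_left_of_ae_eq_univ (ae_eq_univ.2 hTae)

/-- Two-sided expansion of the area of the tilted section. -/
theorem exists_area_tilt_bounds (hdim : 2 ≤ finrank ℝ W) {lam : ℝ} (hlam : 0 ≤ lam)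
    (hlam1 : lam ≤ 1 / 400) {v : WithLp 2 (W × ℝ) → ℝ} {K : ℝ≥0} (hv : LipschitzWith K v)
    (hK : K ≤ 1 / 2) {S : Set (WithLp 2 (W × ℝ))} (hS : MeasurableSet S)
    (hSΩ : S ⊆ solidCone W lam) (hSb : Bornology.IsBounded S)
    (hv0 : ∀ x ∈ solidCone W lam \ S, v =ᶠ[𝓝 x] 0) :
    ∫⁻ x in solidCone W lam, ‖fderiv ℝ v x‖ₑ ^ 2 ≠ ∞ ∧
    ∃ a : ℝ, euclideanHausdorffMeasure (finrank ℝ (WithLp 2 (W × ℝ))) (tilt lam v '' S) =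
        ENNReal.ofReal a ∧
      (volume S).toReal + (∫⁻ x in solidCone W lam, ‖fderiv ℝ v x‖ₑ ^ 2).toReal / 16 ≤ a ∧
      a ≤ (volume S).toReal + 4 * (∫⁻ x in solidCone W lam, ‖fderiv ℝ v x‖ₑ ^ 2).toReal := by
  have : Nontrivial W := nontrivial_of_finrank_pos (R := ℝ) (by omega)
  have hΩm : MeasurableSet (solidCone W lam) := (isOpen_solidCone lam).measurableSet
  have hvol : volume S ≠ ∞ := hSb.measure_lt_top.ne
  obtain ⟨R, hR⟩ := hSb.subset_ball 0
  have hR' : ∀ x ∈ solidCone W lam, R ≤ ‖x‖ → v x = 0 := fun x hx hxR =>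
    (hv0 x ⟨hx, fun hxS => by
      have := hR hxS
      rw [mem_ball_zero_iff] at this
      linarith⟩).eq_of_nhds
  -- The trace estimate lives on the whole cone and the area only on `S`. Both see the same energy,
  -- since `v` vanishes near each point of the cone outside `S`.
  have hD : ∫⁻ x in solidCone W lam, ‖fderiv ℝ v x‖ₑ ^ 2 = ∫⁻ x in S, ‖fderiv ℝ v x‖ₑ ^ 2 := by
    rw [← lintegral_indicator hΩm, ← lintegral_indicator hS]
    refine lintegral_congr fun x => ?_
    by_cases hxS : x ∈ S
    · simp [hxS, hSΩ hxS]
    · by_cases hxΩ : x ∈ solidCone W lam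
      · rw [indicator_of_mem hxΩ, indicator_of_notMem hxS,
          enorm_fderiv_eq_zero (hv0 x ⟨hxΩ, hxS⟩), zero_pow two_ne_zero]
      · simp [hxS, hxΩ]
  have hfdK : ∀ x, ‖fderiv ℝ v x‖ ≤ K := fun x => norm_fderiv_le_of_lipschitz ℝ hv
  have hfdm : Measurable fun x => ‖fderiv ℝ v x‖ ^ 2 := (measurable_fderiv ℝ v).norm.pow_const 2
  have hfdint : IntegrableOn (fun x => ‖fderiv ℝ v x‖ ^ 2) S :=
    Measure.integrableOn_of_bounded (M := (K : ℝ) ^ 2) hvol hfdm.aestronglyMeasurable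
      (Eventually.of_forall fun x => by
        rw [Real.norm_of_nonneg (sq_nonneg _)]
        exact pow_le_pow_left₀ (norm_nonneg (fderiv ℝ v x)) (hfdK x) 2)
  have hDeq : ∫⁻ x in S, ‖fderiv ℝ v x‖ₑ ^ 2 =
      ENNReal.ofReal (∫ x in S, ‖fderiv ℝ v x‖ ^ 2) := by
    rw [ofReal_integral_eq_lintegral_ofReal hfdint (Eventually.of_forall fun x => sq_nonneg _)]
    exact lintegral_congr fun x => (ofReal_norm_sq _).symm
  have hDreal : (∫⁻ x in solidCone W lam, ‖fderiv ℝ v x‖ₑ ^ 2).toReal =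
      ∫ x in S, ‖fderiv ℝ v x‖ ^ 2 := by
    rw [hD, hDeq, ENNReal.toReal_ofReal (integral_nonneg fun x => sq_nonneg _)]
  have hDfin : ∫⁻ x in solidCone W lam, ‖fderiv ℝ v x‖ₑ ^ 2 ≠ ∞ := by
    rw [hD, hDeq]
    exact ENNReal.ofReal_ne_top
  have hflux := integral_verticalRate_bounds hdim hlam (by linarith) hv hR' hDfin
  have hk : ∫ x in solidCone W lam, verticalRate lam v x = ∫ x in S, verticalRate lam v x :=
    setIntegral_eq_of_subset_of_forall_sdiff_eq_zero hΩm hSΩ fun x hx =>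
      verticalRate_eq_zero (hv0 x hx).eq_of_nhds
  rw [hDreal, hk] at hflux
  have hkint : IntegrableOn (verticalRate lam v) S :=
    (integral_verticalRate_solidCone hlam hv hR').1.mono_set hSΩ
  have hb := tiltJacobian_bounds hlam (by linarith) hv hK
  have h1int : IntegrableOn (fun _ : WithLp 2 (W × ℝ) => (1 : ℝ)) S := integrableOn_const hvol
  have hlowint := (h1int.add hkint).add (hfdint.div_const 8)
  have huppint := (h1int.add hkint).add (hfdint.const_mul 4)
  have hJint : IntegrableOn (tiltJacobian lam v) S :=
    huppint.mono' (measurable_tiltJacobian lam hv.continuous.measurable).aestronglyMeasurable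
      (Eventually.of_forall fun x => by
        rw [Real.norm_of_nonneg (show 0 ≤ tiltJacobian lam v x from Real.sqrt_nonneg _)]
        exact (hb x).2.2)
  have hlow := setIntegral_mono hlowint hJint fun x => (hb x).2.1
  have hupp := setIntegral_mono hJint huppint fun x => (hb x).2.2
  rw [integral_add' (h1int.add hkint) (hfdint.div_const 8), integral_add' h1int hkint,
    integral_div, setIntegral_const, smul_eq_mul, mul_one] at hlow
  rw [integral_add' (h1int.add hkint) (hfdint.const_mul 4), integral_add' h1int hkint,
    integral_const_mul, setIntegral_const, smul_eq_mul, mul_one] at hupp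
  refine ⟨hDfin, ∫ x in S, tiltJacobian lam v x, ?_, ?_, ?_⟩
  · rw [euclideanHausdorffMeasure_tilt_image hlam (by linarith) hv hK hS,
      ofReal_integral_eq_lintegral_ofReal hJint (Eventually.of_forall fun x => Real.sqrt_nonneg _)]
  · rw [hDreal]
    have hDnn : 0 ≤ ∫ x in S, ‖fderiv ℝ v x‖ ^ 2 := integral_nonneg fun x => sq_nonneg _
    -- The threshold enters here: `1/8 - 21/400 ≥ 1/16`.
    have : lam * ∫ x in S, ‖fderiv ℝ v x‖ ^ 2 ≤ 1 / 400 * ∫ x in S, ‖fderiv ℝ v x‖ ^ 2 := by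
      gcongr
    change volume.real S + _ ≤ _
    linarith [hflux.2]
  · rw [hDreal]
    change _ ≤ volume.real S + _
    linarith [hflux.1]

/-- A Lipschitz function on the cone with vanishing Dirichlet energy and bounded support is zero. -/
theorem eq_zero_of_lintegral_fderiv_eq_zero (hdim : 2 ≤ finrank ℝ W) {lam : ℝ}
    {g : WithLp 2 (W × ℝ) → ℝ} {K : ℝ≥0} (hg : LipschitzWith K g) {R : ℝ}
    (hR : ∀ x ∈ solidCone W lam, R ≤ ‖x‖ → g x = 0)
    (h : ∫⁻ x in solidCone W lam, ‖fderiv ℝ g x‖ₑ ^ 2 = 0) : ∀ x ∈ solidCone W lam, g x = 0 := by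
  have hfr : finrank ℝ (WithLp 2 (W × ℝ)) = finrank ℝ W + 1 := by
    rw [(WithLp.linearEquiv 2 ℝ (W × ℝ)).finrank_eq, finrank_prod, finrank_self]
  have hardy := hardy_inequality (by omega) (isOpen_solidCone lam).measurableSet
    (zero_notMem_solidCone (W := W) lam)
    (fun s hs x hx => smul_mem_solidCone (one_pos.trans_le hs) hx) hg hR
  have hQ : Measurable fun x => ‖g x‖ₑ ^ 2 / ‖x‖ₑ ^ 2 :=
    (hg.continuous.measurable.enorm.pow_const 2).div (measurable_enorm.pow_const 2)
  rw [h, mul_zero, nonpos_iff_eq_zero, lintegral_eq_zero_iff hQ] at hardy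
  have hae : g =ᵐ[volume.restrict (solidCone W lam)] 0 := by
    filter_upwards [hardy] with x hx
    simpa [ENNReal.div_eq_zero_iff] using hx
  exact eqOn_open_of_ae_eq hae (isOpen_solidCone lam) hg.continuous.continuousOn
    continuousOn_const

end AreaExpansion

/-! ### Return to the original coordinates. -/

section Transfer

/-- The coordinates `((x', x_n), x_{n+1})` on the ambient space. -/
def ambientMap (m : ℕ) (z : WithLp 2 (WithLp 2 (EuclideanSpace ℝ (Fin m) × ℝ) × ℝ)) :
    Ambient (m + 1) :=
  WithLp.toLp 2 (Fin.snoc (α := fun _ => ℝ)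
    (Fin.snoc (α := fun _ => ℝ) (fun i => z.fst.fst i) z.fst.snd : Fin (m + 1) → ℝ) z.snd)

theorem isometry_ambientMap (m : ℕ) : Isometry (ambientMap m) := by
  refine Isometry.of_dist_eq fun x y => ?_
  rw [EuclideanSpace.dist_eq, WithLp.prod_dist_eq_of_L2, WithLp.prod_dist_eq_of_L2,
    EuclideanSpace.dist_eq, Fin.sum_univ_castSucc, Fin.sum_univ_castSucc,
    Real.sq_sqrt (by positivity), Real.sq_sqrt (by positivity)]
  simp [ambientMap]

/-- The inclusion of the hyperplane `x_{n+1} = 0`. -/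
def sectionMap (m : ℕ) (x : WithLp 2 (EuclideanSpace ℝ (Fin m) × ℝ)) : Ambient (m + 1) :=
  ambientMap m (WithLp.toLp 2 (x, 0))

theorem isometry_sectionMap (m : ℕ) : Isometry (sectionMap m) := by
  refine (isometry_ambientMap m).comp (Isometry.of_dist_eq fun x y => ?_)
  rw [WithLp.prod_dist_eq_of_L2]
  simp [Real.sqrt_sq]

theorem ambientMap_last (m : ℕ) (z) : ambientMap m z (Fin.last (m + 1)) = z.snd := by
  simp [ambientMap]

theorem axis_eq (m : ℕ) : axis (m + 1) = (Fin.last m).castSucc := by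
  ext
  simp [axis]

theorem ambientMap_axis (m : ℕ) (z) : ambientMap m z (axis (m + 1)) = z.fst.snd := by
  simp [ambientMap, axis_eq]

theorem ambientMap_castSucc (m : ℕ) (z) (i : Fin m) :
    ambientMap m z i.castSucc.castSucc = z.fst.fst i := by
  simp [ambientMap]

theorem omega_ambientMap (m : ℕ) (lam : ℝ) (z) (s : ℝ) :
    omega (m + 1) lam (ambientMap m z) s = lam * √(‖z.fst.fst‖ ^ 2 + s ^ 2) := by
  rw [omega, Finset.sum_filter, Fin.sum_univ_castSucc, Fin.sum_univ_castSucc,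
    EuclideanSpace.norm_sq_eq]
  simp [ambientMap_castSucc]

theorem sectionMap_mem_axialSection_iff (m : ℕ) (lam : ℝ) (x) :
    sectionMap m x ∈ axialSection (m + 1) lam ↔ x ∈ solidCone (EuclideanSpace ℝ (Fin m)) lam := by
  simp only [axialSection, cone, mem_ofPred_eq, sectionMap, ambientMap_last, ambientMap_axis,
    omega_ambientMap, solidCone]
  simp [Real.sqrt_sq]

theorem exists_sectionMap_eq (m : ℕ) {lam : ℝ} {y : Ambient (m + 1)}
    (hy : y ∈ axialSection (m + 1) lam) : ∃ x, sectionMap m x = y := by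
  refine ⟨WithLp.toLp 2 (WithLp.toLp 2 fun i => y i.castSucc.castSucc, y (Fin.last m).castSucc), ?_⟩
  have h0 : y (Fin.last (m + 1)) = 0 := hy.2
  ext i
  refine Fin.lastCases ?_ (fun i => ?_) i
  · rw [sectionMap, ambientMap_last, h0]
    rfl
  · refine Fin.lastCases ?_ (fun i => ?_) i
    · rw [sectionMap, ← axis_eq, ambientMap_axis]
      rfl
    · rw [sectionMap, ambientMap_castSucc]
      rfl

theorem curve_sectionMap (m : ℕ) (lam : ℝ) (v : WithLp 2 (EuclideanSpace ℝ (Fin m) × ℝ) → ℝ) (x) :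
    curve (m + 1) lam (sectionMap m x) (v x) = ambientMap m (tilt lam v x) := by
  have hne : ∀ i : Fin (m + 1), i.castSucc ≠ Fin.last (m + 1) := fun i => (Fin.castSucc_lt_last i).ne
  ext i
  refine Fin.lastCases ?_ (fun i => ?_) i
  · simp [curve, ambientMap_last, tilt]
  · refine Fin.lastCases ?_ (fun i => ?_) i
    · rw [← axis_eq, ambientMap_axis]
      have h : axis (m + 1) ≠ Fin.last (m + 1) := by rw [axis_eq]; exact hne _
      simp only [curve, h, if_false, if_true, sectionMap, omega_ambientMap, ambientMap_axis]
      simp [tilt, lift, axisVector, Real.sqrt_sq]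
      ring
    · rw [ambientMap_castSucc]
      have h : i.castSucc.castSucc ≠ axis (m + 1) := by
        rw [axis_eq]
        exact fun h => (Fin.castSucc_lt_last i).ne (Fin.castSucc_injective _ h)
      simp only [curve, h, hne, if_false, sectionMap, ambientMap_castSucc]
      simp [tilt, axisVector]

/-- Gives a function on the whole space, to which Rademacher's theorem and `fderiv` apply; inside
the open cone its derivative does not depend on the extension chosen. -/
theorem exists_lipschitz_extension {X : Type*} [PseudoMetricSpace X] {s : Set X} {f : s → ℝ}
    {K : ℝ≥0} (hf : LipschitzWith K f) : ∃ F : X → ℝ, LipschitzWith K F ∧ ∀ x : s, F x = f x := by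
  classical
  obtain ⟨F, hF, h⟩ := LipschitzOnWith.extend_real (f := fun x => if hx : x ∈ s then f ⟨x, hx⟩ else 0)
    (s := s) (K := K) (by
      intro x hx y hy
      simpa [hx, hy] using hf ⟨x, hx⟩ ⟨y, hy⟩)
  exact ⟨F, hF, fun x => by rw [← h x.2]; simp⟩

/-- Expansion of the area, in the form needed for the variations. -/
theorem exists_area_bounds {m : ℕ} (hm : 2 ≤ m) {lam : ℝ} (hlam : 0 ≤ lam) (hlam1 : lam ≤ 1 / 400)
    {f : closure (axialSection (m + 1) lam) → ℝ} {K : ℝ≥0} (hf : LipschitzWith K f)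
    (hfc : HasCompactSupport f) :
    ∃ V D δ : ℝ, 0 ≤ V ∧ 0 ≤ D ∧ 0 < δ ∧ (f ≠ 0 → 0 < D) ∧
      ∀ t : ℝ, 0 ≤ t → t < δ → ∃ a : ℝ, area (m + 1) lam f t = ENNReal.ofReal a ∧
        V + t ^ 2 * D ≤ a ∧ a ≤ V + t ^ 2 * (64 * D) := by
  set W := EuclideanSpace ℝ (Fin m)
  have hW : 2 ≤ finrank ℝ W := by simpa [W] using hm
  have hfr : finrank ℝ (WithLp 2 (W × ℝ)) = m + 1 := by
    rw [(WithLp.linearEquiv 2 ℝ (W × ℝ)).finrank_eq, finrank_prod, finrank_self]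
    simp [W]
  obtain ⟨F, hF, hFf⟩ := exists_lipschitz_extension hf
  set g : WithLp 2 (W × ℝ) → ℝ := fun x => F (sectionMap m x) with hgdef
  have hg : LipschitzWith K g := by
    have := hF.comp (isometry_sectionMap m).lipschitz
    rwa [mul_one] at this
  set C : Set (Ambient (m + 1)) := Subtype.val '' tsupport f with hCdef
  have hC : IsCompact C := IsCompact.image hfc continuous_subtype_val
  have hcont : Continuous (sectionMap m) := (isometry_sectionMap m).continuous
  set S : Set (WithLp 2 (W × ℝ)) := solidCone W lam ∩ sectionMap m ⁻¹' C with hSdef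
  have hSm : MeasurableSet S :=
    (isOpen_solidCone lam).measurableSet.inter (hC.isClosed.preimage hcont).measurableSet
  have hSb : Bornology.IsBounded S :=
    ((isometry_sectionMap m).antilipschitz.isBounded_preimage hC.isBounded).subset
      inter_subset_right
  have hmem : ∀ x ∈ solidCone W lam, sectionMap m x ∈ closure (axialSection (m + 1) lam) :=
    fun x hx => subset_closure ((sectionMap_mem_axialSection_iff m lam x).2 hx)
  have hg0 : ∀ x ∈ solidCone W lam, x ∉ S → g x = 0 := by
    intro x hx hxS
    have h1 : (⟨sectionMap m x, hmem x hx⟩ : closure (axialSection (m + 1) lam)) ∉ tsupport f :=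
      fun h => hxS ⟨hx, _, h, rfl⟩
    rw [hgdef]
    exact (hFf ⟨_, hmem x hx⟩).trans (image_eq_zero_of_notMem_tsupport h1)
  have hg0' : ∀ x ∈ solidCone W lam \ S, g =ᶠ[𝓝 x] 0 := by
    intro x hx
    have hopen : IsOpen (solidCone W lam ∩ (sectionMap m ⁻¹' C)ᶜ) :=
      (isOpen_solidCone lam).inter (hC.isClosed.preimage hcont).isOpen_compl
    filter_upwards [hopen.mem_nhds ⟨hx.1, fun h => hx.2 ⟨hx.1, h⟩⟩] with y hy
    exact hg0 y hy.1 fun h => hy.2 h.2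
  set E : ℝ≥0∞ := ∫⁻ x in solidCone W lam, ‖fderiv ℝ g x‖ₑ ^ 2 with hE
  -- The coordinate map is an isometry carrying `tilt` to the flow, hence it preserves the Hausdorff
  -- measure of the image.
  have harea : ∀ t, area (m + 1) lam f t = euclideanHausdorffMeasure (m + 1)
      (tilt lam (fun x => t * g x) '' S) := by
    intro t
    rw [area, ← (isometry_ambientMap m).euclideanHausdorffMeasure_image, image_image]
    congr 1
    ext y
    constructor
    · rintro ⟨z, ⟨hz, hzs⟩, rfl⟩
      obtain ⟨x, hx⟩ := exists_sectionMap_eq m hz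
      have hxc : x ∈ solidCone W lam := by
        rwa [← sectionMap_mem_axialSection_iff m lam x, hx]
      refine ⟨x, ⟨hxc, z, hzs, hx.symm⟩, ?_⟩
      beta_reduce
      rw [← curve_sectionMap]
      simp only [flow, hgdef, hx, hFf]
    · rintro ⟨x, ⟨hxc, z, hzs, hzx⟩, rfl⟩
      refine ⟨z, ⟨?_, hzs⟩, ?_⟩
      · rw [hzx]
        exact (sectionMap_mem_axialSection_iff m lam x).2 hxc
      · beta_reduce
        rw [← curve_sectionMap]
        simp only [flow, hgdef, ← hzx, hFf]
  have hEt : ∀ t : ℝ, ∫⁻ x in solidCone W lam, ‖fderiv ℝ (fun x => t * g x) x‖ₑ ^ 2 =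
      ENNReal.ofReal (t ^ 2) * E := by
    intro t
    rw [hE, ← lintegral_const_mul _ ((measurable_fderiv ℝ g).enorm.pow_const 2)]
    refine lintegral_congr fun x => ?_
    exact enorm_fderiv_const_mul_sq t g x
  -- Ensures that `t g` has Lipschitz constant at most `1/2`, as the Jacobian bounds require.
  set δ : ℝ := 1 / (2 * (K + 1)) with hδ
  have hδpos : 0 < δ := by positivity
  have hbounds : ∀ t : ℝ, 0 ≤ t → t < δ → ENNReal.ofReal (t ^ 2) * E ≠ ∞ ∧
      ∃ a : ℝ, area (m + 1) lam f t = ENNReal.ofReal a ∧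
        (volume S).toReal + t ^ 2 * (E.toReal / 16) ≤ a ∧
        a ≤ (volume S).toReal + t ^ 2 * (64 * (E.toReal / 16)) := by
    intro t ht0 ht
    have hK : ‖t‖₊ * K ≤ 1 / 2 := by
      rw [← NNReal.coe_le_coe]
      simp only [NNReal.coe_mul, coe_nnnorm, Real.norm_of_nonneg ht0, NNReal.coe_div, NNReal.coe_one,
        NNReal.coe_ofNat]
      have h1 : t * (2 * (K + 1)) < 1 := by rwa [hδ, lt_div_iff₀ (by positivity)] at ht
      nlinarith [K.2]
    have hv : LipschitzWith (‖t‖₊ * K) fun x => t * g x := (lipschitzWith_smul t).comp hg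
    obtain ⟨hfin, a, ha, hlow, hupp⟩ := exists_area_tilt_bounds hW hlam hlam1 hv hK hSm
      inter_subset_left hSb fun x hx => by
        filter_upwards [hg0' x hx] with y hy
        simp [hy]
    rw [hEt] at hfin hlow hupp
    rw [ENNReal.toReal_mul, ENNReal.toReal_ofReal (sq_nonneg t)] at hlow hupp
    refine ⟨hfin, a, ?_, by linarith, by linarith⟩
    rw [harea, ← ha, hfr]
  -- Finiteness was obtained only for `t g` with small `t`; one positive `t` transfers it to `g`.
  have hEfin : E ≠ ∞ := by
    have h := (hbounds (δ / 2) (by positivity) (by linarith)).1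
    rintro hEt
    rw [hEt, ENNReal.mul_top (by simpa using hδpos.ne')] at h
    exact h rfl
  -- With `D = E/16`, the upper coefficient `4E` becomes `64 D`.
  refine ⟨(volume S).toReal, E.toReal / 16, δ, ENNReal.toReal_nonneg,
    div_nonneg ENNReal.toReal_nonneg (by norm_num), hδpos, fun hf0 => ?_,
    fun t ht0 ht => (hbounds t ht0 ht).2⟩
  refine div_pos (ENNReal.toReal_pos (fun hE0 => hf0 ?_) hEfin) (by norm_num)
  obtain ⟨R, hR⟩ := hSb.subset_ball 0
  have hgz := eq_zero_of_lintegral_fderiv_eq_zero hW hg (R := R) (fun x hx hxR => hg0 x hx fun h => by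
    have := hR h
    rw [mem_ball_zero_iff] at this
    linarith) hE0
  -- Vanishing on the open section passes to its closure, the domain of `f`, by continuity.
  have hcl : closure (axialSection (m + 1) lam) ⊆ {y | F y = 0} := by
    refine closure_minimal (fun y hy => ?_) (isClosed_eq hF.continuous continuous_const)
    obtain ⟨x, rfl⟩ := exists_sectionMap_eq m hy
    exact hgz x ((sectionMap_mem_axialSection_iff m lam x).1 hy)
  ext z
  rw [← hFf z]
  exact hcl z.2

end Transfer

end ConeStability

end

/-! ### The variations read off from the quadratic area bounds. -/

theorem theorem3p3 (n : ℕ) (hn : 3 ≤ n) :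
    ∃ lamStar : ℝ, 0 < lamStar ∧
      ∀ lam : ℝ, 0 < lam → lam ≤ lamStar →
        ∀ f : closure (ConeStability.axialSection n lam) → ℝ,
          (∃ K : NNReal, LipschitzWith K f) → HasCompactSupport f →
            ConeStability.lowerFirstVariation n lam f = 0 ∧
            0 ≤ ConeStability.lowerDerivSqrt n lam f ∧
            0 ≤ ConeStability.lowerSecondVariation n lam f ∧
            (f ≠ 0 →
              0 < ConeStability.lowerDerivSqrt n lam f ∧
              0 < ConeStability.lowerSecondVariation n lam f) := by
  obtain ⟨m, rfl⟩ : ∃ m, n = m + 1 := ⟨n - 1, by omega⟩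
  refine ⟨1 / 400, by norm_num, fun lam hlam hlam1 f ⟨K, hK⟩ hfc => ?_⟩
  obtain ⟨V, D, δ, hV, hD, hδ, hDpos, hbd⟩ :=
    ConeStability.exists_area_bounds (by omega) hlam.le hlam1 hK hfc
  have hdiff : ∀ t : ℝ, 0 ≤ t → t < δ → ∃ q : ℝ,
      (ConeStability.area (m + 1) lam f t : EReal) - (ConeStability.area (m + 1) lam f 0 : EReal) =
        (q : EReal) ∧ t ^ 2 * D ≤ q ∧ q ≤ t ^ 2 * (64 * D) := by
    intro t ht0 ht
    obtain ⟨a, ha, ha1, ha2⟩ := hbd t ht0 ht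
    obtain ⟨b, hb, hb1, hb2⟩ := hbd 0 le_rfl hδ
    -- At `t = 0` the two bounds coincide, which identifies the initial area as `V`.
    have hbV : b = V := by
      refine le_antisymm ?_ ?_ <;> nlinarith
    have ha0 : 0 ≤ a := by nlinarith [mul_nonneg (sq_nonneg t) hD]
    refine ⟨a - V, ?_, by linarith, by linarith⟩
    rw [ha, hb, hbV, EReal.coe_ennreal_ofReal, EReal.coe_ennreal_ofReal, max_eq_left ha0,
      max_eq_left hV, EReal.coe_sub]
  have hev : ∀ᶠ t : ℝ in 𝓝[>] 0, 0 < t ∧ t < δ := Ioo_mem_nhdsGT hδ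
  have hsqrt : (D : EReal) ≤ ConeStability.lowerDerivSqrt (m + 1) lam f := by
    refine le_liminf_of_le (by isBoundedDefault) ?_
    have hev2 : ∀ᶠ s : ℝ in 𝓝[>] 0, 0 < s ∧ s < δ ^ 2 := Ioo_mem_nhdsGT (by positivity)
    filter_upwards [hev2] with s hs
    obtain ⟨q, hq, hq1, -⟩ := hdiff (√s) (Real.sqrt_nonneg s) ((Real.sqrt_lt' hδ).2 hs.2)
    rw [Real.sqrt_zero, hq, ← EReal.coe_div, EReal.coe_le_coe_iff, le_div_iff₀ hs.1]
    rw [Real.sq_sqrt hs.1.le] at hq1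
    linarith
  have hsecond : (D : EReal) ≤ liminf (fun t : ℝ => ((ConeStability.area (m + 1) lam f t : EReal) -
      (ConeStability.area (m + 1) lam f 0 : EReal)) / ((t ^ 2 : ℝ) : EReal)) (𝓝[>] (0 : ℝ)) := by
    refine le_liminf_of_le (by isBoundedDefault) ?_
    filter_upwards [hev] with t ht
    obtain ⟨q, hq, hq1, -⟩ := hdiff t ht.1.le ht.2
    rw [hq, ← EReal.coe_div, EReal.coe_le_coe_iff, le_div_iff₀ (pow_pos ht.1 2)]
    linarith
  have hD' : (0 : EReal) ≤ (D : EReal) := EReal.coe_nonneg.2 hD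
  refine ⟨?_, hD'.trans hsqrt, mul_nonneg (by norm_num) (hD'.trans hsecond), fun hf0 => ?_⟩
  · refine Tendsto.liminf_eq ?_
    have hup : Tendsto (fun t : ℝ => ((t * (64 * D) : ℝ) : EReal)) (𝓝[>] 0) (𝓝 0) := by
      have h1 : Tendsto (fun t : ℝ => t * (64 * D)) (𝓝[>] 0) (𝓝 0) := by
        have h2 : Continuous fun t : ℝ => t * (64 * D) := by fun_prop
        have h3 := h2.tendsto 0
        rw [zero_mul] at h3
        exact h3.mono_left nhdsWithin_le_nhds
      exact EReal.tendsto_coe.2 h1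
    -- The first difference quotient is squeezed between `0` and `64 D t`, so it has the actual
    -- limit `0`, not merely that lower limit.
    refine tendsto_of_tendsto_of_tendsto_of_le_of_le' tendsto_const_nhds hup ?_ ?_
    · filter_upwards [hev] with t ht
      obtain ⟨q, hq, hq1, -⟩ := hdiff t ht.1.le ht.2
      rw [hq, ← EReal.coe_div]
      exact EReal.coe_nonneg.2 (div_nonneg ((mul_nonneg (sq_nonneg t) hD).trans hq1) ht.1.le)
    · filter_upwards [hev] with t ht
      obtain ⟨q, hq, -, hq2⟩ := hdiff t ht.1.le ht.2
      rw [hq, ← EReal.coe_div, EReal.coe_le_coe_iff, div_le_iff₀ ht.1]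
      linarith
  · have hD0 : (0 : EReal) < (D : EReal) := EReal.coe_pos.2 (hDpos hf0)
    exact ⟨hD0.trans_le hsqrt, EReal.mul_pos (by norm_num) (hD0.trans_le hsecond)⟩
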